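/- **Setting.** Let $d\in\mathbb N$. Let $a\in\mathbb R^d$, let $D$ be a real positive semidefinite $d\times d$ matrix, let $z\ge 0$, and let $r$ be a probability measure on $\mathbb R^d\setminus\{0\}$ whose support is compact (as a subset of $\mathbb R^d$). Let $\Psi$ be the Lévy symbol $$\Psi(-i\xi)=i\langle a,\xi\rangle-\langle\xi,D\xi\rangle+z\int_{\mathbb R^d\setminus\{0\}}\big(e^{i\langle x,\xi\rangle}-1\big)\,dr(x),\qquad\text{i.e.}\quad \Psi(\eta)=-\langle a,\eta\rangle+\langle\eta,D\eta\rangle+z\int_{\mathbb R^d\setminus\{0\}}\big(e^{-\langle x,\eta\rangle}-1\big)\,dr(x),$$ with $\langle\cdot,\cdot\rangle$ extended bilinearly to $\eta\in\mathbb C^d$, and let $C^{(n)}_{X_1\dots X_n}=\dfrac{\partial^n\Psi(\xi)}{\partial\xi_{X_1}\cdots\partial\xi_{X_n}}\Big|_{\xi=0}$. Let $\lambda=\lambda^{(2)}$ be a real symmetric positive definite $d\times d$ matrix, $V(x)=\sum_{k,l}\lambda_{kl}x_kx_l$, and $f_\zeta=e^{-\zeta V}$ for $\Re\zeta>0$,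 $f=f_1$. With $\mathcal F(u)(\xi)=\int u(x)e^{i\langle\xi,x\rangle}dx$, let $\nu_t=\mathcal F^{-1}(e^{t\Psi(-i\,\cdot)})\in\mathcal S'(\mathbb R^d)$, $\Phi^\zeta_t=\nu_t*f_\zeta$, $\Phi_t=\Phi_t^1$, and $\Psi(\nabla)u=\mathcal F^{-1}\big(\Psi(-i\xi)\,\mathcal F(u)(\xi)\big)$. **Feynman graphs.** $\bar F(m)$ is the set of graphs with $m$ distinguishable full vertices, each with two distinguishable legs, and with indistinguishable inner empty vertices and indistinguishable outer empty vertices, in which every leg of a full vertex is met by exactly one edge, each edge joins a leg of a full vertex to an empty vertex, each empty vertex is met by at least one edge, and each outer empty vertex is met by exactly one edge. The value $\mathcal V[G](t,\phi)$ of $G\in\bar F(m)$ is obtained by assigning an index $X\in\{1,\dots,d\}$ to each leg of a full vertex, multiplying with $\lambda_{X_1X_2}$ for each full vertex whose legs carry $X_1,X_2$, with $\phi_X$ for each outer empty vertex joined to a leg carrying $X$, and with $t\,C^{(n)}_{X_1\dots X_n}$ for each inner empty vertex joined to legs carrying $X_1,\dots,X_n$, and summing over all assignments. **Theorem 2.21.**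 $\Phi$ is the unique solution of the Cauchy problem $\partial_t\Phi_t=\Psi(\nabla)\Phi_t$ $(t>0)$, $\Phi_0=f$. (Here a solution is a family $u_t$, $t\ge0$, of continuous integrable functions with $\mathcal F(u_t)$ and $\Psi(-i\,\cdot)\mathcal F(u_t)$ integrable, such that the equation holds pointwise, $u_0=f$ and $u_t\to f$ pointwise as $t\searrow0$, and such that the time derivative and the limit $t\searrow 0$ can be taken out of the Fourier transform, i.e. $\partial_t\mathcal F(u_t)(\xi)=\Psi(-i\xi)\mathcal F(u_t)(\xi)$ for $t>0$ and $\mathcal F(u_t)(\xi)\to\mathcal F(f)(\xi)$ as $t\searrow0$, for all $\xi$.) Moreover, for all $t>0$ and $\phi\in\mathbb R^d$ there are constants $A,\sigma>0$ such that the following hold. 1. The function $\zeta\mapsto\Phi^\zeta_t(\phi)$ satisfies the hypotheses of Sokal's version of Watson's theorem on $C_R=\{\zeta:\Re\zeta^{-1}>R^{-1}\}$ for every $R>0$, with the constants $A,\sigma$ independent of $R$: it is analytic on $C_R$, and for $a_m=\frac{(-1)^m}{m!}\sum_{G\in\bar F(m)}\mathcal V[G](t,\phi)$, $$\Big|\Phi_t^\zeta(\phi)-\sum_{m=0}^{N-1}a_m\zeta^m\Big|\le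 A\,\sigma^N N!\,|\zeta|^N\qquad\text{for all } N\in\mathbb N_0,\ \zeta\in C_R .$$ 2. The series $$B(\tau,t,\phi)=\sum_{m=0}^\infty\frac{(-\tau)^m}{(m!)^2}\sum_{G\in\bar F(m)}\mathcal V[G](t,\phi)$$ converges for $|\tau|<1/\sigma$ and has an analytic continuation, denoted by the same symbol, to the strip $S_\sigma=\{\tau\in\mathbb C:\operatorname{dist}(\tau,\mathbb R_+)<1/\sigma\}$, where $\mathbb R_+=[0,\infty)$. 3. The integral below converges absolutely, and $$\Phi_t(\phi)=\int_0^\infty e^{-\tau}B(\tau,t,\phi)\,d\tau .$$ -/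

import Mathlib

open MeasureTheory Filter Topology

noncomputable section

namespace LevyBorel

/-- The Euclidean space `ℝ^d`. -/
abbrev E (d : ℕ) : Type := EuclideanSpace ℝ (Fin d)

/-! ### Lévy symbols -/

/-- The data of a Lévy symbol: drift `a`, real positive semidefinite diffusion matrix `D`,
jump frequency `z ≥ 0` and jump distribution `r`, a probability measure on `ℝ^d \ {0}`
(that is, a probability measure on `ℝ^d` without mass at `0`). -/
structure LevyTriple (d : ℕ) where
  a : E d
  D : Matrix (Fin d) (Fin d) ℝ
  z : ℝ
  r : Measure (E d)
  D_posSemidef : D.PosSemidef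
  z_nonneg : 0 ≤ z
  r_prob : IsProbabilityMeasure r
  r_zero : r {0} = 0

variable {d : ℕ}

/-- The symbol `Ψ(η) = -⟨a, η⟩ + ⟨η, D η⟩ + z ∫ (e^{-⟨x, η⟩} - 1) dr(x)`, `η ∈ ℂ^d`, where
`⟨·, ·⟩` is bilinear. Its value at `-iξ` is computed in `LevyTriple.symbol_neg_I`. -/
def LevyTriple.symbol (L : LevyTriple d) (η : Fin d → ℂ) : ℂ :=
  -(∑ k, (L.a k : ℂ) * η k) + (∑ k, ∑ l, η k * (L.D k l : ℂ) * η l)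
    + (L.z : ℂ) * ∫ x, (Complex.exp (-(∑ k, (x k : ℂ) * η k)) - 1) ∂L.r

/-- `ξ ↦ Ψ(-iξ)` for `ξ ∈ ℝ^d`. -/
def LevyTriple.symbolImag (L : LevyTriple d) (ξ : E d) : ℂ :=
  L.symbol (fun k => -Complex.I * (ξ k : ℂ))

/-- `Ψ(-iξ) = i⟨a, ξ⟩ - ⟨ξ, D ξ⟩ + z ∫ (e^{i⟨x, ξ⟩} - 1) dr(x)`. -/
theorem LevyTriple.symbol_neg_I (L : LevyTriple d) (ξ : E d) :
    L.symbolImag ξ = Complex.I * (∑ k, (L.a k : ℂ) * (ξ k : ℂ))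
      - (∑ k, ∑ l, (ξ k : ℂ) * (L.D k l : ℂ) * (ξ l : ℂ))
      + (L.z : ℂ) * ∫ x, (Complex.exp (Complex.I * ∑ k, (x k : ℂ) * (ξ k : ℂ)) - 1) ∂L.r := by
  have hI : Complex.I * Complex.I = -1 := Complex.I_mul_I
  unfold LevyTriple.symbolImag LevyTriple.symbol
  congr 1
  · rw [sub_eq_add_neg, Finset.mul_sum, ← Finset.sum_neg_distrib, ← Finset.sum_neg_distrib]
    congr 1
    · exact Finset.sum_congr rfl fun k _ => by ring
    · refine Finset.sum_congr rfl fun k _ => ?_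
      rw [← Finset.sum_neg_distrib]
      exact Finset.sum_congr rfl fun l _ => by linear_combination (ξ k * L.D k l * ξ l : ℂ) * hI
  · congr 2
    funext x
    congr 2
    rw [Finset.mul_sum, ← Finset.sum_neg_distrib]
    exact Finset.sum_congr rfl fun k _ => by ring

/-- The coefficients of the symbol,
`C^{(n)}_{X₁…Xₙ} = ∂ⁿ Ψ(ξ) / ∂ξ_{X₁} … ∂ξ_{Xₙ}` at `ξ = 0`, `ξ ∈ ℝ^d`. -/
def LevyTriple.coeff (L : LevyTriple d) (n : ℕ) (X : Fin n → Fin d) : ℂ :=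
  iteratedFDeriv ℝ n (fun ξ : E d => L.symbol (fun k => (ξ k : ℂ))) 0
    (fun i => EuclideanSpace.single (X i) (1 : ℝ))

/-! ### Fourier transform, convolution semigroup and Cauchy problem -/

/-- `ℱ(u)(ξ) = ∫ u(x) e^{i⟨ξ, x⟩} dx`. -/
def fourier (u : E d → ℂ) (ξ : E d) : ℂ :=
  ∫ x, u x * Complex.exp (Complex.I * (inner ℝ ξ x : ℝ))

/-- `ℱ⁻¹(u)(x) = (2π)^{-d} ∫ u(ξ) e^{-i⟨ξ, x⟩} dξ`. -/
def fourierInv (u : E d → ℂ) (x : E d) : ℂ :=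
  (((2 * Real.pi) ^ d : ℝ) : ℂ)⁻¹ * ∫ ξ, u ξ * Complex.exp (-Complex.I * (inner ℝ ξ x : ℝ))

/-- The pairing `⟨ν_t, g⟩` of `ν_t = ℱ⁻¹(e^{tΨ(-i·)}) ∈ 𝒮'(ℝ^d)` with a test function `g`:
`⟨ν_t, g⟩ = ∫ e^{tΨ(-iξ)} ℱ⁻¹(g)(ξ) dξ`. -/
def LevyTriple.nu (L : LevyTriple d) (t : ℝ) (g : E d → ℂ) : ℂ :=
  ∫ ξ, Complex.exp ((t : ℂ) * L.symbolImag ξ) * fourierInv g ξ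

/-- The convolution `(ν_t * g)(φ) = ⟨ν_t, g(φ - ·)⟩`. -/
def LevyTriple.convolve (L : LevyTriple d) (t : ℝ) (g : E d → ℂ) (φ : E d) : ℂ :=
  L.nu t (fun x => g (φ - x))

/-- The quadratic form `V(x) = ⟨λ, x ⊗ x⟩ = ∑ λ_{kl} x_k x_l`. -/
def quadV (lam : Matrix (Fin d) (Fin d) ℝ) (x : E d) : ℝ :=
  ∑ k, ∑ l, lam k l * x k * x l

/-- `f_ζ = e^{-ζV}`. -/
def initial (lam : Matrix (Fin d) (Fin d) ℝ) (ζ : ℂ) (x : E d) : ℂ :=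
  Complex.exp (-ζ * (quadV lam x : ℂ))

/-- `Φ_t^ζ(φ) = (ν_t * f_ζ)(φ)`. -/
def LevyTriple.Phi (L : LevyTriple d) (lam : Matrix (Fin d) (Fin d) ℝ) (ζ : ℂ) (t : ℝ)
    (φ : E d) : ℂ :=
  L.convolve t (initial lam ζ) φ

/-- The pseudo-differential operator `Ψ(∇)`: since `ℱ(∇u)(ξ) = -iξ ℱ(u)(ξ)`, it acts as
`Ψ(∇)u = ℱ⁻¹(Ψ(-iξ) ℱ(u)(ξ))`. -/
def LevyTriple.op (L : LevyTriple d) (u : E d → ℂ) : E d → ℂ :=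
  fourierInv (fun ξ => L.symbolImag ξ * fourier u ξ)

/-- `u` solves the Cauchy problem `∂u_t/∂t = Ψ(∇)u_t` for `t > 0`, `u_0 = f`. The functions `u_t`
are continuous and integrable and lie in the domain of the operator `Ψ(∇)`, the equation and the
initial condition hold pointwise, and the time derivative and the limit `t ↘ 0` may be taken out of
the Fourier transform. -/
structure LevyTriple.IsCauchySolution (L : LevyTriple d) (f : E d → ℂ)
    (u : ℝ → E d → ℂ) : Prop where
  continuous : ∀ t, 0 ≤ t → Continuous (u t)
  integrable : ∀ t, 0 ≤ t → Integrable (u t)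
  integrable_fourier : ∀ t, 0 ≤ t → Integrable (fourier (u t))
  integrable_symbol : ∀ t, 0 ≤ t → Integrable (fun ξ => L.symbolImag ξ * fourier (u t) ξ)
  initial_eq : u 0 = f
  initial_tendsto : ∀ φ, Tendsto (fun t => u t φ) (𝓝[>] 0) (𝓝 (f φ))
  fourier_tendsto : ∀ ξ, Tendsto (fun t => fourier (u t) ξ) (𝓝[>] 0) (𝓝 (fourier f ξ))
  hasDerivAt : ∀ t, 0 < t → ∀ φ, HasDerivAt (fun s => u s φ) (L.op (u t) φ) t
  fourier_hasDerivAt : ∀ t, 0 < t → ∀ ξ,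
    HasDerivAt (fun s => fourier (u s) ξ) (L.symbolImag ξ * fourier (u t) ξ) t

/-! ### Generalized amputated Feynman graphs -/

/-- The legs of `m` distinguishable inner full vertices with two distinguishable legs each. -/
abbrev Leg (m : ℕ) : Type := Fin m × Fin 2

/-- A Feynman graph with `m` inner full vertices with two legs each, whose empty vertices carry
labels. Every leg of a full vertex is met by exactly one edge, and every edge joins such a leg with
an (inner or outer) empty vertex, so the edges are given by a map `edge`. Each empty vertex is met
by an edge, and an outer empty vertex is met by one edge only. -/
structure LabelledGraph (m : ℕ) where
  numInner : ℕ
  numOuter : ℕ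
  edge : Leg m → Fin numInner ⊕ Fin numOuter
  edge_surjective : Function.Surjective edge
  outer_unique : ∀ l l' v, edge l = Sum.inr v → edge l' = Sum.inr v → l = l'

/-- Two labelled graphs are identified if they differ by relabellings of the inner empty and of the
outer empty vertices. -/
def LabelledGraph.Rel {m : ℕ} (G H : LabelledGraph m) : Prop :=
  ∃ (e : Fin G.numInner ≃ Fin H.numInner) (o : Fin G.numOuter ≃ Fin H.numOuter),
    ∀ l, H.edge l = Sum.map e o (G.edge l)

instance LabelledGraph.setoid (m : ℕ) : Setoid (LabelledGraph m) where
  r := LabelledGraph.Rel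
  iseqv :=
    { refl := fun G => ⟨Equiv.refl _, Equiv.refl _, fun l => by simp⟩
      symm := by
        rintro G H ⟨e, o, h⟩
        refine ⟨e.symm, o.symm, fun l => ?_⟩
        rw [h l, Sum.map_map]
        simp
      trans := by
        rintro G H K ⟨e, o, h⟩ ⟨e', o', h'⟩
        refine ⟨e.trans e', o.trans o', fun l => ?_⟩
        rw [h' l, h l, Sum.map_map]
        rfl }

/-- `F̄(m)`: the generalized amputated Feynman graphs with `m` inner full vertices with two legs
each; the inner empty vertices are indistinguishable, and so are the outer empty ones. -/
def FeynmanGraph (m : ℕ) : Type := Quotient (LabelledGraph.setoid m)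

/-- The set of legs of full vertices that are joined with the empty vertex `v`. -/
def LabelledGraph.legs {m : ℕ} (G : LabelledGraph m) (v : Fin G.numInner ⊕ Fin G.numOuter) :
    Finset (Leg m) :=
  Finset.univ.filter (fun l => G.edge l = v)

/-- `C_J = C^{(n)}_{X_{l₁}…X_{lₙ}}` for a set `J = {l₁, …, lₙ}` of legs. The order of the legs is
irrelevant, the coefficients being symmetric. -/
def LevyTriple.coeffOn (L : LevyTriple d) {m : ℕ} (X : Leg m → Fin d) (J : Finset (Leg m)) : ℂ :=
  L.coeff J.card (fun i => X (J.equivFin.symm i))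

/-- The Feynman rules: give a value in `{1, …, d}` to each leg of a full vertex, multiply with
a factor `λ_{X₁X₂}` for each full vertex, with `φ_X` for each outer empty vertex and with `t C_J`
for each inner empty vertex, and sum over all values of the legs. -/
def LabelledGraph.value {m : ℕ} (L : LevyTriple d) (lam : Matrix (Fin d) (Fin d) ℝ) (t : ℝ)
    (φ : E d) (G : LabelledGraph m) : ℂ :=
  ∑ X : Leg m → Fin d,
    (∏ j : Fin m, (lam (X (j, 0)) (X (j, 1)) : ℂ)) *
    (∏ v : Fin G.numOuter, ∏ l ∈ G.legs (Sum.inr v), (φ (X l) : ℂ)) *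
    ∏ v : Fin G.numInner, ((t : ℂ) * L.coeffOn X (G.legs (Sum.inl v)))

theorem LabelledGraph.legs_map {m : ℕ} {G H : LabelledGraph m}
    (e : Fin G.numInner ≃ Fin H.numInner) (o : Fin G.numOuter ≃ Fin H.numOuter)
    (h : ∀ l, H.edge l = Sum.map e o (G.edge l)) (v : Fin G.numInner ⊕ Fin G.numOuter) :
    H.legs (Sum.map e o v) = G.legs v := by
  ext l
  have hinj : Function.Injective (Sum.map e o) := Sum.map_injective.2 ⟨e.injective, o.injective⟩
  simp only [LabelledGraph.legs, Finset.mem_filter, Finset.mem_univ, true_and, h l]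
  exact hinj.eq_iff

theorem LabelledGraph.value_eq_of_rel {m : ℕ} (L : LevyTriple d)
    (lam : Matrix (Fin d) (Fin d) ℝ) (t : ℝ) (φ : E d) (G H : LabelledGraph m)
    (h : G.Rel H) : G.value L lam t φ = H.value L lam t φ := by
  obtain ⟨e, o, h⟩ := h
  unfold LabelledGraph.value
  refine Finset.sum_congr rfl fun X _ => ?_
  congr 1
  · congr 1
    refine Fintype.prod_equiv o _ _ fun v => ?_
    rw [← LabelledGraph.legs_map e o h]
    rfl
  · refine Fintype.prod_equiv e _ _ fun v => ?_
    rw [← LabelledGraph.legs_map e o h]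
    rfl

/-- The value `𝒱[G](t, φ)` of a Feynman graph. -/
def FeynmanGraph.value {m : ℕ} (L : LevyTriple d) (lam : Matrix (Fin d) (Fin d) ℝ) (t : ℝ)
    (φ : E d) (G : FeynmanGraph m) : ℂ :=
  Quotient.lift (LabelledGraph.value L lam t φ) (LabelledGraph.value_eq_of_rel L lam t φ) G

/-- There are only finitely many labelled graphs, hence only finitely many Feynman graphs. -/
instance LabelledGraph.finite (m : ℕ) : Finite (LabelledGraph m) := by
  let N := Fintype.card (Leg m) + 1
  let T := Σ k : Fin N, Σ q : Fin N, (Leg m → Fin k.1 ⊕ Fin q.1)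
  have hle : ∀ G : LabelledGraph m, G.numInner + G.numOuter ≤ Fintype.card (Leg m) := fun G => by
    simpa using Fintype.card_le_of_surjective G.edge G.edge_surjective
  let F : LabelledGraph m → T := fun G =>
    ⟨⟨G.numInner, by have := hle G; omega⟩, ⟨G.numOuter, by have := hle G; omega⟩, G.edge⟩
  refine Finite.of_injective F ?_
  rintro ⟨k, q, e, h₁, h₂⟩ ⟨k', q', e', h₁', h₂'⟩ h
  have hk : k = k' := congrArg (fun p : T => p.1.1) h
  have hq : q = q' := congrArg (fun p : T => p.2.1.1) h
  subst hk hq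
  have he : e = e' := eq_of_heq (Sigma.mk.inj (eq_of_heq (Sigma.mk.inj h).2)).2
  subst he
  rfl

instance FeynmanGraph.finite (m : ℕ) : Finite (FeynmanGraph m) :=
  inferInstanceAs (Finite (Quotient (LabelledGraph.setoid m)))

instance FeynmanGraph.fintype (m : ℕ) : Fintype (FeynmanGraph m) := Fintype.ofFinite _

/-- `∑_{G ∈ F̄(m)} 𝒱[G](t, φ)`. -/
def LevyTriple.graphSum (L : LevyTriple d) (lam : Matrix (Fin d) (Fin d) ℝ) (t : ℝ) (φ : E d)
    (m : ℕ) : ℂ :=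
  ∑ G : FeynmanGraph m, G.value L lam t φ

/-! ### The setting of Watson's theorem -/

/-- `C_R = {ζ : Re ζ⁻¹ > R⁻¹}`. The union over all `R > 0` is the half plane `Re ζ > 0`. -/
def circleRegion (R : ℝ) : Set ℂ := {ζ | R⁻¹ < (ζ⁻¹).re}

/-- `S_σ = {τ : dist(τ, ℝ₊) < 1/σ}`. -/
def strip (σ : ℝ) : Set ℂ := {τ | Metric.infDist τ ((fun x : ℝ => (x : ℂ)) '' Set.Ici 0) < 1 / σ}

/-- The hypotheses of Sokal's version of Watson's theorem for a function `h` and a formal power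
series `∑ a_m ζ^m` on `C_R`, with constants `A` and `σ`. -/
structure WatsonSokal (h : ℂ → ℂ) (a : ℕ → ℂ) (R A σ : ℝ) : Prop where
  analytic : AnalyticOnNhd ℂ h (circleRegion R)
  bound : ∀ N : ℕ, ∀ ζ ∈ circleRegion R,
    ‖h ζ - ∑ m ∈ Finset.range N, a m * ζ ^ m‖ ≤ A * σ ^ N * (N.factorial : ℝ) * ‖ζ‖ ^ N

end LevyBorel

end

namespace LevyBorel

variable {d : ℕ} {lam : Matrix (Fin d) (Fin d) ℝ}

/-! ### The Fourier transform -/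

/-! The function `e^{tΨ(-iξ)}` is the characteristic function of a probability measure `μ`, the law
at time `t` of a Lévy process `X`. It is built by hand as a point mass convolved with a Gaussian and
a compound Poisson law (`LevyTriple.exists_law`). Compact support of the jumps gives `μ` all
exponential moments, so its Laplace transform is `e^{tΨ(η)}` for every complex `η`.

With `W = V(φ - X) ≥ 0` this yields `Φ_t^ζ(φ) = E e^{-ζW}` (`LevyTriple.Phi_eq_integral`), and the
analytic claims become statements about the Laplace transform of one nonnegative random variable.
Since `V` is quadratic, `√W` grows at most linearly in `X`, so `E e^{√W}` is finite. The Taylor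
remainder `|w|^N / N!` of `e^{-w}` on `Re w ≥ 0`, combined with `W^N ≤ 4^N (N!)² e^{√W}`, gives the
Watson bound on the whole half plane with `σ = 4` and `A = E e^{√W}` (`watsonSokal_laplace`).

The Borel sum is obtained directly, without invoking Watson's theorem. For `J(w) = ∑ (-w)^m / (m!)²`
one has `e^{-x} = ∫ e^{-τ} J(τx) dτ`, so `B(τ) = E J(τW)` works by Fubini (`exists_borel_laplace`).
It is analytic on the strip because `|J(τx)| ≤ e^{√x}` there.

The coefficients are the moments `E W^m`. Joint moments of `φ - X` are derivatives at `0` of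
`exp(⟨φ, η⟩ + tΨ(η))`, and Faà di Bruno's formula turns them into sums over set partitions
(`LevyTriple.moment_eq`). Each singleton part contributes either `φ` or `tC`. Marking the singletons
that take `φ` identifies the terms with Feynman graphs, one for one (`sum_weight_eq`).

For the Cauchy problem, the Fourier transform decouples the frequencies into scalar linear
equations. Uniqueness is that of these equations plus Fourier inversion; existence is
differentiation under the integral, using `|e^{tΨ(-iξ)}| ≤ 1`. -/

theorem norm_cexp_I_mul_ofReal (x : ℝ) : ‖Complex.exp (Complex.I * x)‖ = 1 := by
  rw [mul_comm]; exact Complex.norm_exp_ofReal_mul_I x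

theorem norm_cexp_neg_I_mul_ofReal (x : ℝ) : ‖Complex.exp (-Complex.I * x)‖ = 1 := by
  simpa using norm_cexp_I_mul_ofReal (-x)

/-- The two conventions differ by the factor `2π` in the phase; this lets Mathlib's inversion
theorem be transferred. -/
theorem fourier_eq_fourierInv (u : E d → ℂ) (w : E d) :
    fourier u ((2 * Real.pi) • w) = FourierTransform.fourierInv u w := by
  rw [Real.fourierInv_eq']
  refine integral_congr_ae (ae_of_all _ fun x => ?_)
  simp only [smul_eq_mul, real_inner_smul_left]
  rw [mul_comm, real_inner_comm]
  congr 2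
  push_cast
  ring

theorem fourierInv_fourier {u : E d → ℂ} (hc : Continuous u) (hi : Integrable u)
    (hf : Integrable (fourier u)) : fourierInv (fourier u) = u := by
  have hpi : (0 : ℝ) < 2 * Real.pi := by positivity
  have h1 : Integrable (FourierTransform.fourierInv u : E d → ℂ) := by
    have := hf.comp_smul hpi.ne'
    simpa only [fourier_eq_fourierInv] using this
  have h2 : Integrable (FourierTransform.fourier u : E d → ℂ) := by
    have := h1.comp_neg
    simpa only [Real.fourierInv_eq_fourier_neg, neg_neg] using this
  have h3 := hc.fourier_fourierInv_eq hi h2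
  funext x
  have h4 := congrFun h3 x
  rw [Real.fourier_eq'] at h4
  rw [← h4, fourierInv]
  -- The substitution `ξ = 2πw` produces the normalisation `(2π)^{-d}`.
  have h5 := Measure.integral_comp_smul (volume : Measure (E d))
    (fun ξ => fourier u ξ * Complex.exp (-Complex.I * (inner ℝ ξ x : ℝ))) (2 * Real.pi)
  rw [finrank_euclideanSpace_fin] at h5
  have h6 : ((((2 * Real.pi) ^ d : ℝ) : ℂ)⁻¹ * ∫ ξ, fourier u ξ *
      Complex.exp (-Complex.I * (inner ℝ ξ x : ℝ))) = ∫ w : E d, fourier u ((2 * Real.pi) • w) *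
        Complex.exp (-Complex.I * (inner ℝ ((2 * Real.pi) • w) x : ℝ)) := by
    rw [h5, abs_of_pos (by positivity)]
    rw [Complex.real_smul]
    push_cast
    ring
  rw [h6]
  refine integral_congr_ae (ae_of_all _ fun w => ?_)
  simp only [smul_eq_mul, fourier_eq_fourierInv, real_inner_smul_left]
  rw [mul_comm]
  congr 2
  push_cast
  ring

theorem continuous_fourier {u : E d → ℂ} (hi : Integrable u) : Continuous (fourier u) := by
  refine continuous_of_dominated (bound := fun x => ‖u x‖) (fun ξ => ?_) (fun ξ => ?_) hi.norm ?_
  · exact hi.aestronglyMeasurable.mul (by fun_prop)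
  · refine ae_of_all _ fun x => ?_
    rw [norm_mul, norm_cexp_I_mul_ofReal, mul_one]
  · exact ae_of_all _ fun x => by fun_prop

/-! ### Gaussian initial conditions -/

theorem quadV_eq_dotProduct (lam : Matrix (Fin d) (Fin d) ℝ) (x : E d) :
    quadV lam x = x.ofLp ⬝ᵥ lam.mulVec x.ofLp := by
  simp only [quadV, dotProduct, Matrix.mulVec, Finset.mul_sum]
  exact Finset.sum_congr rfl fun k _ => Finset.sum_congr rfl fun l _ => by ring

open scoped MatrixOrder in
theorem exists_transpose_mul_self {A : Matrix (Fin d) (Fin d) ℝ} (hA : A.PosSemidef) :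
    ∃ B : Matrix (Fin d) (Fin d) ℝ, A = B.transpose * B := by
  obtain ⟨B, hB⟩ := CStarAlgebra.nonneg_iff_eq_star_mul_self.mp hA.nonneg
  exact ⟨B, by rw [hB, Matrix.star_eq_conjTranspose, Matrix.conjTranspose_eq_transpose_of_trivial]⟩

/-- Factor `λ = BᵀB`; definiteness makes `B` injective, hence invertible. This reduces Gaussian
integrals to isotropic ones and shows that `√V` grows linearly. -/
theorem exists_equiv_quadV (hlam : lam.PosDef) :
    ∃ S : E d ≃L[ℝ] E d, ∀ x, quadV lam x = ‖S x‖ ^ 2 := by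
  obtain ⟨B, hB⟩ := exists_transpose_mul_self hlam.posSemidef
  set T : E d →L[ℝ] E d := Matrix.toEuclideanCLM (𝕜 := ℝ) B with hT
  have hV : ∀ x, quadV lam x = ‖T x‖ ^ 2 := fun x => by
    rw [quadV_eq_dotProduct, hB, ← Matrix.mulVec_mulVec, Matrix.dotProduct_mulVec,
      Matrix.vecMul_transpose, EuclideanSpace.real_norm_sq_eq]
    simp only [hT, Matrix.ofLp_toEuclideanCLM, dotProduct, sq]
  have hinj : LinearMap.ker (T : E d →ₗ[ℝ] E d) = ⊥ := by
    refine LinearMap.ker_eq_bot'.2 fun x hx => ?_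
    by_contra hne
    have h1 : 0 < quadV lam x := by
      rw [quadV_eq_dotProduct]
      have := hlam.dotProduct_mulVec_pos (x := x.ofLp) (fun h => hne (by ext i; simp [h]))
      simpa using this
    have hx' : T x = 0 := hx
    simp [hV, hx'] at h1
  refine ⟨(LinearEquiv.ofInjectiveEndo (T : E d →ₗ[ℝ] E d) (LinearMap.ker_eq_bot.1 hinj)).toContinuousLinearEquiv,
    fun x => ?_⟩
  rw [hV]
  rfl
theorem continuous_quadV (lam : Matrix (Fin d) (Fin d) ℝ) : Continuous (quadV lam) := by
  unfold quadV
  fun_prop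

theorem quadV_nonneg (hlam : lam.PosDef) (x : E d) : 0 ≤ quadV lam x := by
  obtain ⟨S, hS⟩ := exists_equiv_quadV hlam
  rw [hS]; positivity

theorem exists_quadV_le (hlam : lam.PosDef) : ∃ c, 0 < c ∧ ∀ x, quadV lam x ≤ (c * ‖x‖) ^ 2 := by
  obtain ⟨S, hS⟩ := exists_equiv_quadV hlam
  refine ⟨‖(S : E d →L[ℝ] E d)‖ + 1, by positivity, fun x => ?_⟩
  rw [hS]
  gcongr
  refine ((S : E d →L[ℝ] E d).le_opNorm x).trans ?_
  gcongr
  linarith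

theorem continuous_initial (lam : Matrix (Fin d) (Fin d) ℝ) (ζ : ℂ) :
    Continuous (initial lam ζ) := by
  have := continuous_quadV lam
  unfold initial
  fun_prop

/-- Change of variables under a linear equivalence. -/
theorem integral_comp_equiv (S : E d ≃L[ℝ] E d) (g : E d → ℂ) :
    ∫ x, g (S x) = (|(S : E d →L[ℝ] E d).det|⁻¹ : ℝ) • ∫ y, g y := by
  have hdet : LinearMap.det (S : E d →ₗ[ℝ] E d) ≠ 0 := S.toLinearEquiv.isUnit_det'.ne_zero
  have h := Measure.map_linearMap_addHaar_eq_smul_addHaar (volume : Measure (E d)) hdet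
  have h2 := (S.toHomeomorph.measurableEmbedding).integral_map (μ := volume) g
  have h3 : Measure.map S.toHomeomorph (volume : Measure (E d)) =
    ENNReal.ofReal |(LinearMap.det (S : E d →ₗ[ℝ] E d))⁻¹| • volume := h
  rw [h3, integral_smul_measure] at h2
  rw [ENNReal.toReal_ofReal (abs_nonneg _), abs_inv] at h2
  exact h2.symm

theorem integrable_comp_equiv (S : E d ≃L[ℝ] E d) {g : E d → ℂ} (hg : Integrable g) :
    Integrable fun x => g (S x) := by
  have hdet : LinearMap.det (S : E d →ₗ[ℝ] E d) ≠ 0 := S.toLinearEquiv.isUnit_det'.ne_zero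
  have h := Measure.map_linearMap_addHaar_eq_smul_addHaar (volume : Measure (E d)) hdet
  have h3 : Measure.map S.toHomeomorph (volume : Measure (E d)) =
    ENNReal.ofReal |(LinearMap.det (S : E d →ₗ[ℝ] E d))⁻¹| • volume := h
  have h2 := (S.toHomeomorph.measurableEmbedding).integrable_map_iff (μ := volume) (g := g)
  rw [h3] at h2
  exact h2.1 (hg.smul_measure ENNReal.ofReal_ne_top)

theorem integrable_initial (hlam : lam.PosDef) {ζ : ℂ} (hζ : 0 < ζ.re) :
    Integrable (initial lam ζ) := by
  obtain ⟨S, hS⟩ := exists_equiv_quadV hlam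
  have h := integrable_comp_equiv S (GaussianFourier.integrable_cexp_neg_mul_sq_norm_add hζ 0
    (0 : E d))
  refine h.congr (ae_of_all _ fun x => ?_)
  simp [initial, hS]

/-- Substituting `y = Sx` leaves an isotropic Gaussian integral at frequency `Tξ`, with `T` the
adjoint of `S⁻¹`. Its modulus decays like `exp(-Re(ζ⁻¹)‖Tξ‖²/4)`. -/
theorem exists_norm_fourier_initial_le (hlam : lam.PosDef) {ζ : ℂ} (hζ : 0 < ζ.re) :
    ∃ K δ : ℝ, 0 < δ ∧ ∀ ξ, ‖fourier (initial lam ζ) ξ‖ ≤ K * Real.exp (-δ * ‖ξ‖ ^ 2) := by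
  obtain ⟨S, hS⟩ := exists_equiv_quadV hlam
  set T := (S.symm : E d →L[ℝ] E d).adjoint with hT
  have hre : 0 < (ζ⁻¹).re := by
    rw [Complex.inv_re]
    exact div_pos hζ (Complex.normSq_pos.2 fun h => by simp [h] at hζ)
  -- The summand `1` keeps `M` positive also for `d = 0`.
  set M := ‖(S : E d →L[ℝ] E d)‖ + 1 with hM
  have hM0 : 0 < M := by positivity
  set c : ℂ := ((|(S : E d →L[ℝ] E d).det|⁻¹ : ℝ) : ℂ) *
    (Real.pi / ζ) ^ (Module.finrank ℝ (E d) / 2 : ℂ) with hc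
  have hkey : ∀ ξ, fourier (initial lam ζ) ξ =
      c * Complex.exp (Complex.I ^ 2 * ‖T ξ‖ ^ 2 / (4 * ζ)) := by
    intro ξ
    rw [hc, mul_assoc, ← GaussianFourier.integral_cexp_neg_mul_sq_norm_add hζ Complex.I (T ξ),
      ← Complex.real_smul, ← integral_comp_equiv S]
    refine integral_congr_ae (ae_of_all _ fun x => ?_)
    simp only [initial, hS, ← Complex.exp_add, hT, ContinuousLinearMap.adjoint_inner_left]
    simp
  refine ⟨‖c‖, (ζ⁻¹).re / (4 * M ^ 2), by positivity, fun ξ => ?_⟩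
  rw [hkey, norm_mul]
  gcongr
  rw [Complex.norm_exp]
  refine Real.exp_le_exp.2 ?_
  -- The lower bound on `T` comes from `⟨Tξ, Sξ⟩ = ‖ξ‖²` and Cauchy–Schwarz.
  have h1 : ‖ξ‖ ≤ M * ‖T ξ‖ := by
    rcases eq_or_ne ‖ξ‖ 0 with h0 | h0
    · rw [h0]; positivity
    have : ‖ξ‖ * ‖ξ‖ ≤ ‖T ξ‖ * (M * ‖ξ‖) := by
      calc ‖ξ‖ * ‖ξ‖ = inner ℝ ξ ξ := (real_inner_self_eq_norm_mul_norm ξ).symm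
        _ = inner ℝ (T ξ) (S ξ) := by rw [hT, ContinuousLinearMap.adjoint_inner_left]; simp
        _ ≤ ‖T ξ‖ * ‖S ξ‖ := real_inner_le_norm _ _
        _ ≤ _ := by
          gcongr
          refine ((S : E d →L[ℝ] E d).le_opNorm ξ).trans ?_
          gcongr
          linarith
    have hpos : 0 < ‖ξ‖ := lt_of_le_of_ne (norm_nonneg _) (Ne.symm h0)
    nlinarith
  have h2 : (Complex.I ^ 2 * (‖T ξ‖ : ℂ) ^ 2 / (4 * ζ)).re = -((ζ⁻¹).re / 4 * ‖T ξ‖ ^ 2) := by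
    have : (Complex.I ^ 2 * (‖T ξ‖ : ℂ) ^ 2 / (4 * ζ)) = ((-(‖T ξ‖ ^ 2 / 4) : ℝ) : ℂ) * ζ⁻¹ := by
      rw [Complex.I_sq]; push_cast; field_simp
    rw [this, Complex.re_ofReal_mul]; ring
  rw [h2]
  have h3 : ‖ξ‖ ^ 2 ≤ M ^ 2 * ‖T ξ‖ ^ 2 := by
    rw [← mul_pow]; gcongr
  have h4 : (ζ⁻¹).re / (4 * M ^ 2) * ‖ξ‖ ^ 2 ≤ (ζ⁻¹).re / (4 * M ^ 2) * (M ^ 2 * ‖T ξ‖ ^ 2) := by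
    gcongr
  have h5 : (ζ⁻¹).re / (4 * M ^ 2) * (M ^ 2 * ‖T ξ‖ ^ 2) = (ζ⁻¹).re / 4 * ‖T ξ‖ ^ 2 := by
    field_simp
  linarith

end LevyBorel

namespace LevyBorel

variable {d : ℕ} {lam : Matrix (Fin d) (Fin d) ℝ}

noncomputable section

/-! ### Laplace transforms and exponential moments -/

/-- The measure `μ` has exponential moments of every order. -/
def HasExpMoments (μ : Measure (E d)) : Prop :=
  ∀ c : ℝ, 0 ≤ c → Integrable (fun x => Real.exp (c * ‖x‖)) μ

/-- The complex Laplace transform `∫ e^{-⟨x, η⟩} dμ(x)`. -/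
def laplace (μ : Measure (E d)) (η : Fin d → ℂ) : ℂ :=
  ∫ x, Complex.exp (-(∑ k, (x k : ℂ) * η k)) ∂μ

theorem continuous_pairing (η : Fin d → ℂ) :
    Continuous fun x : E d => -(∑ k, (x k : ℂ) * η k) := by
  fun_prop

theorem norm_pairing_le (η : Fin d → ℂ) (x : E d) :
    ‖∑ k, (x k : ℂ) * η k‖ ≤ (∑ k, ‖η k‖) * ‖x‖ := by
  rw [Finset.sum_mul]
  refine (norm_sum_le _ _).trans (Finset.sum_le_sum fun k _ => ?_)
  rw [norm_mul, mul_comm]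
  gcongr
  simpa using PiLp.norm_apply_le x k

theorem norm_cexp_pairing_le (η : Fin d → ℂ) (x : E d) :
    ‖Complex.exp (-(∑ k, (x k : ℂ) * η k))‖ ≤ Real.exp ((∑ k, ‖η k‖) * ‖x‖) := by
  refine (Complex.norm_exp_le_exp_norm _).trans (Real.exp_le_exp.2 ?_)
  rw [norm_neg]
  exact norm_pairing_le η x

theorem HasExpMoments.isFiniteMeasure {μ : Measure (E d)} (h : HasExpMoments μ) :
    IsFiniteMeasure μ := by
  have := h 0 le_rfl
  simp only [zero_mul, Real.exp_zero] at this
  exact (integrable_const_iff_isFiniteMeasure one_ne_zero).1 this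

theorem HasExpMoments.integrable_pairing {μ : Measure (E d)} (h : HasExpMoments μ)
    (η : Fin d → ℂ) : Integrable (fun x : E d => Complex.exp (-(∑ k, (x k : ℂ) * η k))) μ :=
  (h _ (Finset.sum_nonneg fun k _ => norm_nonneg (η k))).mono'
    (continuous_pairing η).cexp.aestronglyMeasurable
    (ae_of_all _ (norm_cexp_pairing_le η))

theorem laplace_zero (μ : Measure (E d)) : laplace μ 0 = (μ.real Set.univ : ℂ) := by
  simp [laplace]

theorem isProbabilityMeasure_of_laplace_zero {μ : Measure (E d)} (h : HasExpMoments μ)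
    (h0 : laplace μ 0 = 1) : IsProbabilityMeasure μ := by
  have := h.isFiniteMeasure
  rw [laplace_zero] at h0
  have h1 : μ.real Set.univ = 1 := by exact_mod_cast h0
  exact ⟨by rwa [← ENNReal.toReal_eq_one_iff]⟩

theorem hasExpMoments_dirac (x : E d) : HasExpMoments (Measure.dirac x) := fun c _ =>
  integrable_dirac (by simp)

theorem laplace_dirac (x : E d) (η : Fin d → ℂ) :
    laplace (Measure.dirac x) η = Complex.exp (-(∑ k, (x k : ℂ) * η k)) := by
  rw [laplace, integral_dirac]

/-- The norm is bounded on the support, which has full measure. Compactness of the jump support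
enters the argument only through this lemma. -/
theorem HasExpMoments.of_isCompact_support {μ : Measure (E d)} [IsFiniteMeasure μ]
    (hμ : IsCompact μ.support) : HasExpMoments μ := by
  intro c hc
  obtain ⟨M, hM⟩ := hμ.isBounded.exists_norm_le
  refine Integrable.of_bound (C := Real.exp (c * M))
    (by fun_prop) ?_
  filter_upwards [Measure.support_mem_ae (μ := μ)] with x hx
  rw [Real.norm_eq_abs, Real.abs_exp]
  gcongr
  exact hM x hx

/-- Submultiplicativity of exponential moments under convolution. -/
theorem HasExpMoments.conv {μ ν : Measure (E d)} (hμ : HasExpMoments μ) (hν : HasExpMoments ν) :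
    HasExpMoments (μ.conv ν) ∧ ∀ c, 0 ≤ c → ∫ x, Real.exp (c * ‖x‖) ∂(μ.conv ν) ≤
      (∫ x, Real.exp (c * ‖x‖) ∂μ) * ∫ x, Real.exp (c * ‖x‖) ∂ν := by
  have := hμ.isFiniteMeasure
  have := hν.isFiniteMeasure
  have key : ∀ c, 0 ≤ c → ∀ x y : E d,
      Real.exp (c * ‖x + y‖) ≤ Real.exp (c * ‖x‖) * Real.exp (c * ‖y‖) := fun c hc x y => by
    rw [← Real.exp_add, ← mul_add]
    gcongr
    exact norm_add_le x y
  have hint : ∀ c, 0 ≤ c →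
      Integrable (fun p : E d × E d => Real.exp (c * ‖p.1 + p.2‖)) (μ.prod ν) := fun c hc => by
    refine ((hμ c hc).mul_prod (hν c hc)).mono' (by fun_prop) (ae_of_all _ fun p => ?_)
    rw [Real.norm_eq_abs, Real.abs_exp]
    exact key c hc p.1 p.2
  refine ⟨fun c hc => ?_, fun c hc => ?_⟩
  · rw [Measure.conv, integrable_map_measure (by fun_prop) (by fun_prop)]
    exact hint c hc
  · rw [Measure.conv, integral_map (by fun_prop) (by fun_prop), ← integral_prod_mul]
    exact integral_mono (hint c hc) ((hμ c hc).mul_prod (hν c hc)) fun p => key c hc p.1 p.2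

theorem laplace_conv {μ ν : Measure (E d)} (hμ : HasExpMoments μ) (hν : HasExpMoments ν)
    (η : Fin d → ℂ) : laplace (μ.conv ν) η = laplace μ η * laplace ν η := by
  have := hμ.isFiniteMeasure
  have := hν.isFiniteMeasure
  rw [laplace, Measure.conv, integral_map (by fun_prop)
    (continuous_pairing η).cexp.aestronglyMeasurable, laplace, laplace, ← integral_prod_mul]
  refine integral_congr_ae (ae_of_all _ fun p => ?_)
  simp only
  rw [← Complex.exp_add, ← neg_add, ← Finset.sum_add_distrib]
  simp [add_mul]

/-- Convolution powers. -/
def convPow (μ : Measure (E d)) : ℕ → Measure (E d)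
  | 0 => Measure.dirac 0
  | n + 1 => μ.conv (convPow μ n)

theorem hasExpMoments_convPow {μ : Measure (E d)} (hμ : HasExpMoments μ) (n : ℕ) :
    HasExpMoments (convPow μ n) := by
  induction n with
  | zero => exact hasExpMoments_dirac 0
  | succ n ih => exact (hμ.conv ih).1

/-- Geometric growth in `n` is what the Poisson weights `sⁿ/n!` can absorb. -/
theorem integral_exp_convPow_le {μ : Measure (E d)} (hμ : HasExpMoments μ) {c : ℝ} (hc : 0 ≤ c)
    (n : ℕ) : ∫ x, Real.exp (c * ‖x‖) ∂(convPow μ n) ≤ (∫ x, Real.exp (c * ‖x‖) ∂μ) ^ n := by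
  induction n with
  | zero => simp [convPow]
  | succ n ih =>
    rw [pow_succ']
    refine ((hμ.conv (hasExpMoments_convPow hμ n)).2 c hc).trans ?_
    gcongr

theorem laplace_convPow {μ : Measure (E d)} (hμ : HasExpMoments μ) (η : Fin d → ℂ) (n : ℕ) :
    laplace (convPow μ n) η = laplace μ η ^ n := by
  induction n with
  | zero => simp [convPow, laplace_dirac]
  | succ n ih =>
    rw [pow_succ', ← ih]
    exact laplace_conv hμ (hasExpMoments_convPow hμ n) η

/-- The compound Poisson law with intensity `s` and jump distribution `μ`. -/
def compoundPoisson (μ : Measure (E d)) (s : ℝ) : Measure (E d) :=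
  Measure.sum fun n => ENNReal.ofReal (Real.exp (-s) * (s ^ n / n.factorial)) • convPow μ n

theorem hasExpMoments_compoundPoisson {μ : Measure (E d)} (hμ : HasExpMoments μ) {s : ℝ}
    (hs : 0 ≤ s) : HasExpMoments (compoundPoisson μ s) := by
  intro c hc
  refine integrable_sum_measure
    (fun n => (hasExpMoments_convPow hμ n c hc).smul_measure ENNReal.ofReal_ne_top) ?_
  set K := ∫ x, Real.exp (c * ‖x‖) ∂μ
  refine Summable.of_nonneg_of_le (fun n => integral_nonneg fun x => norm_nonneg _) (fun n => ?_)
    ((Real.summable_pow_div_factorial (s * K)).mul_left (Real.exp (-s)))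
  rw [integral_smul_measure, ENNReal.toReal_ofReal (by positivity)]
  simp only [Real.norm_eq_abs, Real.abs_exp, smul_eq_mul]
  refine (mul_le_mul_of_nonneg_left (integral_exp_convPow_le hμ hc n) (by positivity)).trans ?_
  rw [mul_pow]
  exact le_of_eq (by ring)

theorem laplace_compoundPoisson {μ : Measure (E d)} (hμ : HasExpMoments μ) {s : ℝ} (hs : 0 ≤ s)
    (η : Fin d → ℂ) :
    laplace (compoundPoisson μ s) η = Complex.exp (s * (laplace μ η - 1)) := by
  have h := hasSum_integral_measure ((hasExpMoments_compoundPoisson hμ hs).integrable_pairing η)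
  have h2 : HasSum (fun n : ℕ => Complex.exp (-s) * ((s * laplace μ η) ^ n / n.factorial))
      (laplace (compoundPoisson μ s) η) := by
    refine h.congr_fun fun n => ?_
    rw [integral_smul_measure, ENNReal.toReal_ofReal (by positivity), mul_pow,
      ← laplace_convPow hμ, laplace, Complex.real_smul]
    push_cast
    ring
  have h3 : HasSum (fun n : ℕ => Complex.exp (-s) * ((s * laplace μ η) ^ n / n.factorial))
      (Complex.exp (-s) * Complex.exp (s * laplace μ η)) := by
    refine HasSum.mul_left _ ?_
    rw [Complex.exp_eq_exp_ℂ]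
    exact NormedSpace.expSeries_div_hasSum_exp _
  rw [h2.unique h3, ← Complex.exp_add]
  congr 1
  ring

/-- The law of `√2 Bᵀ g` for a standard Gaussian vector `g`. -/
def gaussianLaw (B : Matrix (Fin d) (Fin d) ℝ) : Measure (E d) :=
  (Measure.pi fun _ : Fin d => ProbabilityTheory.gaussianReal 0 1).map fun g =>
    (WithLp.toLp 2 ((√2 • B.transpose).mulVec g) : E d)

theorem continuous_gaussianLaw_map (B : Matrix (Fin d) (Fin d) ℝ) : Continuous fun g : Fin d → ℝ =>
    (WithLp.toLp 2 ((√2 • B.transpose).mulVec g) : E d) :=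
  (PiLp.continuous_toLp 2 _).comp (Continuous.matrix_mulVec continuous_const continuous_id)

/-- The norm of the image vector is at most a multiple of `∑ |g_j|`, so the dominating exponential
is a product over independent coordinates. -/
theorem hasExpMoments_gaussianLaw (B : Matrix (Fin d) (Fin d) ℝ) :
    HasExpMoments (gaussianLaw B) := by
  intro c hc
  have hcont := continuous_gaussianLaw_map B
  rw [gaussianLaw, integrable_map_measure (by fun_prop) hcont.aemeasurable]
  obtain ⟨M, hM0, hM⟩ : ∃ M : ℝ, 0 ≤ M ∧ ∀ g : Fin d → ℝ,
      ‖(WithLp.toLp 2 ((√2 • B.transpose).mulVec g) : E d)‖ ≤ M * ∑ j, |g j| := by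
    set T : E d →L[ℝ] E d := Matrix.toEuclideanCLM (𝕜 := ℝ) (√2 • B.transpose) with hT
    refine ⟨‖T‖, norm_nonneg _, fun g => ?_⟩
    have h1 : (WithLp.toLp 2 ((√2 • B.transpose).mulVec g) : E d) = T (WithLp.toLp 2 g) := by
      rw [hT, Matrix.toEuclideanCLM_toLp]
    rw [h1]
    refine (T.le_opNorm _).trans ?_
    gcongr
    rw [EuclideanSpace.norm_eq]
    refine Real.sqrt_le_iff.2 ⟨Finset.sum_nonneg fun j _ => abs_nonneg _, ?_⟩
    exact Finset.sum_sq_le_sq_sum_of_nonneg fun j _ => abs_nonneg (g j)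
  have hprod : Integrable (fun g : Fin d → ℝ => ∏ j, Real.exp (c * M * |g j|))
      (Measure.pi fun _ : Fin d => ProbabilityTheory.gaussianReal 0 1) :=
    Integrable.fintype_prod (f := fun _ (y : ℝ) => Real.exp (c * M * |y|)) fun j =>
      ProbabilityTheory.integrable_exp_mul_abs
        (ProbabilityTheory.integrable_exp_mul_gaussianReal _)
        (ProbabilityTheory.integrable_exp_mul_gaussianReal _)
  refine hprod.mono' ?_ (ae_of_all _ fun g => ?_)
  · exact Continuous.aestronglyMeasurable (by fun_prop)
  · rw [← Real.exp_sum, ← Finset.mul_sum, Function.comp_apply, Real.norm_eq_abs, Real.abs_exp,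
      mul_assoc]
    gcongr
    exact hM g

/-- The exponent is linear in the independent coordinates, so the integral splits into
one-dimensional transforms `e^{z²/2}`. The factor `√2` in the law cancels this one half, in
accordance with the term `⟨η, Dη⟩` of `Ψ`. -/
theorem laplace_gaussianLaw (B : Matrix (Fin d) (Fin d) ℝ) (η : Fin d → ℂ) :
    laplace (gaussianLaw B) η =
      Complex.exp (∑ k, ∑ l, η k * ((B.transpose * B) k l : ℝ) * η l) := by
  have hcont := continuous_gaussianLaw_map B
  set b : Fin d → ℂ := fun j => ∑ k, (B j k : ℂ) * η k with hb
  rw [laplace, gaussianLaw, integral_map hcont.aemeasurable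
    (continuous_pairing η).cexp.aestronglyMeasurable]
  have h1 : ∀ g : Fin d → ℝ, Complex.exp (-(∑ k,
      (((WithLp.toLp 2 ((√2 • B.transpose).mulVec g) : E d) k : ℝ) : ℂ) * η k)) =
      ∏ j, Complex.exp ((-(√2 : ℂ) * b j) * (g j : ℂ)) := fun g => by
    rw [← Complex.exp_sum]
    congr 1
    simp only [hb, Matrix.mulVec, dotProduct, Matrix.smul_apply, Matrix.transpose_apply,
      smul_eq_mul, Complex.ofReal_sum, Complex.ofReal_mul, Finset.sum_mul, Finset.mul_sum,
      ← Finset.sum_neg_distrib]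
    rw [Finset.sum_comm]
    exact Finset.sum_congr rfl fun j _ => Finset.sum_congr rfl fun k _ => by ring
  simp_rw [h1]
  rw [integral_fintype_prod_eq_prod (f := fun j (y : ℝ) => Complex.exp ((-(√2 : ℂ) * b j) * (y : ℂ)))]
  have h2 : ∀ z : ℂ, ∫ y : ℝ, Complex.exp (z * (y : ℂ)) ∂(ProbabilityTheory.gaussianReal 0 1) =
      Complex.exp (z ^ 2 / 2) := fun z => by
    have := ProbabilityTheory.complexMGF_id_gaussianReal (μ := 0) (v := 1) z
    simpa [ProbabilityTheory.complexMGF] using this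
  simp_rw [h2]
  rw [← Complex.exp_sum]
  congr 1
  have h3 : (√2 : ℂ) ^ 2 = 2 := by
    rw [← Complex.ofReal_pow, Real.sq_sqrt (by norm_num)]; norm_num
  have h4 : ∀ j, (-(√2 : ℂ) * b j) ^ 2 / 2 = b j * b j := fun j => by
    rw [mul_pow, neg_sq, h3]; ring
  simp_rw [h4, hb, Finset.sum_mul_sum, Matrix.mul_apply, Matrix.transpose_apply,
    Complex.ofReal_sum, Finset.mul_sum, Finset.sum_mul]
  rw [Finset.sum_comm]
  refine Finset.sum_congr rfl fun k _ => ?_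
  rw [Finset.sum_comm]
  refine Finset.sum_congr rfl fun l _ => Finset.sum_congr rfl fun j _ => ?_
  push_cast
  ring

/-- The convolution semigroup of a Lévy symbol consists of probability measures. -/
theorem LevyTriple.exists_law (L : LevyTriple d) (hr : IsCompact L.r.support) {t : ℝ}
    (ht : 0 ≤ t) : ∃ μ : Measure (E d), IsProbabilityMeasure μ ∧ HasExpMoments μ ∧
      ∀ η, laplace μ η = Complex.exp (t * L.symbol η) := by
  have := L.r_prob
  have hrm : HasExpMoments L.r := HasExpMoments.of_isCompact_support hr
  -- Time is absorbed into the factorisation `tD = BᵀB`.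
  obtain ⟨B, hB⟩ := exists_transpose_mul_self (L.D_posSemidef.smul ht)
  have hs : 0 ≤ t * L.z := mul_nonneg ht L.z_nonneg
  have h1 := hasExpMoments_compoundPoisson hrm hs
  have h2 := (hasExpMoments_gaussianLaw B).conv h1
  have h3 := (hasExpMoments_dirac (t • L.a)).conv h2.1
  have hlap : ∀ η, laplace ((Measure.dirac (t • L.a)).conv ((gaussianLaw B).conv
      (compoundPoisson L.r (t * L.z)))) η = Complex.exp (t * L.symbol η) := fun η => by
    rw [laplace_conv (hasExpMoments_dirac _) h2.1, laplace_conv (hasExpMoments_gaussianLaw B) h1,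
      laplace_dirac, laplace_gaussianLaw, laplace_compoundPoisson hrm hs, ← Complex.exp_add,
      ← Complex.exp_add, ← hB]
    have hint : ∫ x, (Complex.exp (-(∑ k, (x k : ℂ) * η k)) - 1) ∂L.r = laplace L.r η - 1 := by
      rw [integral_sub (hrm.integrable_pairing η) (integrable_const _)]
      simp [laplace]
    rw [LevyTriple.symbol, hint]
    congr 1
    simp only [mul_add, mul_neg, Finset.mul_sum, Matrix.smul_apply, smul_eq_mul, PiLp.smul_apply]
    push_cast
    rw [add_assoc]
    congr 1
    · congr 1
      exact Finset.sum_congr rfl fun k _ => by ring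
    · congr 1
      · exact Finset.sum_congr rfl fun k _ => Finset.sum_congr rfl fun l _ => by ring
      · ring
  -- The total mass is the Laplace transform at `0`, and `Ψ(0) = 0`.
  refine ⟨_, isProbabilityMeasure_of_laplace_zero h3.1 ?_, h3.1, hlap⟩
  rw [hlap]
  simp [LevyTriple.symbol]

end

end LevyBorel

namespace LevyBorel

variable {d : ℕ} {lam : Matrix (Fin d) (Fin d) ℝ}

noncomputable section

/-! ### The symbol on the imaginary axis -/

theorem sum_mul_neg_I (x ξ : E d) :
    -(∑ k, (x k : ℂ) * (-Complex.I * (ξ k : ℂ))) = Complex.I * (inner ℝ ξ x : ℝ) := by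
  rw [PiLp.inner_apply, ← Finset.sum_neg_distrib]
  push_cast
  rw [Finset.mul_sum]
  refine Finset.sum_congr rfl fun k _ => ?_
  simp only [RCLike.inner_apply, conj_trivial]
  push_cast
  ring

theorem laplace_neg_I (μ : Measure (E d)) (ξ : E d) :
    laplace μ (fun k => -Complex.I * (ξ k : ℂ)) =
      ∫ x, Complex.exp (Complex.I * (inner ℝ ξ x : ℝ)) ∂μ := by
  simp only [laplace, sum_mul_neg_I]

/-- At `t = 1`, `e^{Ψ(-iξ)}` is the characteristic function of a probability measure, hence of
modulus at most one. -/
theorem LevyTriple.symbolImag_re_nonpos (L : LevyTriple d) (hr : IsCompact L.r.support) (ξ : E d) :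
    (L.symbolImag ξ).re ≤ 0 := by
  obtain ⟨μ, hμ, -, h⟩ := L.exists_law hr zero_le_one
  have h1 := h (fun k => -Complex.I * (ξ k : ℂ))
  rw [laplace_neg_I] at h1
  have h2 : ‖Complex.exp ((1 : ℝ) * L.symbolImag ξ)‖ ≤ 1 := by
    rw [LevyTriple.symbolImag, ← h1]
    refine (norm_integral_le_integral_norm _).trans ?_
    simp
  rw [Complex.norm_exp, Real.exp_le_one_iff] at h2
  simpa using h2

theorem LevyTriple.norm_exp_symbolImag_le_one (L : LevyTriple d) (hr : IsCompact L.r.support)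
    {t : ℝ} (ht : 0 ≤ t) (ξ : E d) : ‖Complex.exp (t * L.symbolImag ξ)‖ ≤ 1 := by
  rw [Complex.norm_exp, Real.exp_le_one_iff, Complex.re_ofReal_mul]
  exact mul_nonpos_of_nonneg_of_nonpos ht (L.symbolImag_re_nonpos hr ξ)

theorem LevyTriple.continuous_symbolImag (L : LevyTriple d) : Continuous L.symbolImag := by
  have := L.r_prob
  rw [funext L.symbol_neg_I]
  refine Continuous.add (by fun_prop) (continuous_const.mul ?_)
  refine continuous_of_dominated (bound := fun _ => 2) (fun ξ => by fun_prop) (fun ξ => ?_)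
    (integrable_const _) (ae_of_all _ fun x => by fun_prop)
  refine ae_of_all _ fun x => (norm_sub_le _ _).trans ?_
  have : (∑ k, (x k : ℂ) * (ξ k : ℂ)) = ((∑ k, x k * ξ k : ℝ) : ℂ) := by push_cast; rfl
  rw [this, norm_cexp_I_mul_ofReal]
  norm_num

theorem LevyTriple.exists_norm_symbolImag_le (L : LevyTriple d) :
    ∃ C : ℝ, 0 ≤ C ∧ ∀ ξ, ‖L.symbolImag ξ‖ ≤ C * (1 + ‖ξ‖ ^ 2) := by
  have := L.r_prob
  set A := ∑ k, ‖L.a k‖ with hA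
  set Q := ∑ k, ∑ l, ‖L.D k l‖ with hQ
  have hA0 : 0 ≤ A := Finset.sum_nonneg fun k _ => norm_nonneg _
  have hQ0 : 0 ≤ Q := Finset.sum_nonneg fun k _ => Finset.sum_nonneg fun l _ => norm_nonneg _
  have hz := L.z_nonneg
  refine ⟨A + Q + 2 * L.z, by positivity, fun ξ => ?_⟩
  have hk : ∀ k, ‖ξ k‖ ≤ ‖ξ‖ := fun k => PiLp.norm_apply_le ξ k
  rw [L.symbol_neg_I]
  have h1 : ‖Complex.I * ∑ k, (L.a k : ℂ) * (ξ k : ℂ)‖ ≤ A * ‖ξ‖ := by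
    rw [norm_mul, Complex.norm_I, one_mul, hA, Finset.sum_mul]
    refine (norm_sum_le _ _).trans (Finset.sum_le_sum fun k _ => ?_)
    rw [norm_mul, Complex.norm_real, Complex.norm_real]
    gcongr
    exact hk k
  have h2 : ‖∑ k, ∑ l, (ξ k : ℂ) * (L.D k l : ℂ) * (ξ l : ℂ)‖ ≤ Q * ‖ξ‖ ^ 2 := by
    rw [hQ, Finset.sum_mul]
    refine (norm_sum_le _ _).trans (Finset.sum_le_sum fun k _ => ?_)
    rw [Finset.sum_mul]
    refine (norm_sum_le _ _).trans (Finset.sum_le_sum fun l _ => ?_)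
    rw [norm_mul, norm_mul, Complex.norm_real, Complex.norm_real, Complex.norm_real]
    calc ‖ξ k‖ * ‖L.D k l‖ * ‖ξ l‖ ≤ ‖ξ‖ * ‖L.D k l‖ * ‖ξ‖ := by
          gcongr
          · exact hk k
          · exact hk l
      _ = _ := by ring
  have h3 : ‖(L.z : ℂ) * ∫ x, (Complex.exp (Complex.I * ∑ k, (x k : ℂ) * (ξ k : ℂ)) - 1) ∂L.r‖
      ≤ 2 * L.z := by
    rw [norm_mul, Complex.norm_real, Real.norm_of_nonneg hz, mul_comm]
    gcongr
    have := norm_integral_le_of_norm_le_const (μ := L.r) (C := 2)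
      (f := fun x => Complex.exp (Complex.I * ∑ k, (x k : ℂ) * (ξ k : ℂ)) - 1)
      (ae_of_all _ fun x => (norm_sub_le _ _).trans (by
        have : (∑ k, (x k : ℂ) * (ξ k : ℂ)) = ((∑ k, x k * ξ k : ℝ) : ℂ) := by push_cast; rfl
        rw [this, norm_cexp_I_mul_ofReal]
        norm_num))
    simpa using this
  have h4 : ‖ξ‖ ≤ 1 + ‖ξ‖ ^ 2 := by nlinarith [sq_nonneg (‖ξ‖ - 1), norm_nonneg ξ]
  have h5 : A * ‖ξ‖ ≤ A * (1 + ‖ξ‖ ^ 2) := by gcongr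
  have h6 : Q * ‖ξ‖ ^ 2 ≤ Q * (1 + ‖ξ‖ ^ 2) := by gcongr; linarith
  have h7 : 2 * L.z ≤ 2 * L.z * (1 + ‖ξ‖ ^ 2) := by
    have : 0 ≤ 2 * L.z * ‖ξ‖ ^ 2 := by positivity
    linarith
  refine (norm_add_le _ _).trans ?_
  refine (add_le_add (norm_sub_le _ _) le_rfl).trans ?_
  linarith

/-! ### Convolutions -/

theorem fourierInv_comp_sub (f : E d → ℂ) (φ ξ : E d) :
    fourierInv (fun x => f (φ - x)) ξ = (((2 * Real.pi) ^ d : ℝ) : ℂ)⁻¹ *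
      (fourier f ξ * Complex.exp (-Complex.I * (inner ℝ ξ φ : ℝ))) := by
  rw [fourierInv]
  congr 1
  have h := integral_sub_left_eq_self
    (fun y => f y * Complex.exp (-Complex.I * (inner ℝ (φ - y) ξ : ℝ))) volume φ
  simp only [sub_sub_cancel] at h
  rw [h, fourier, ← integral_mul_const]
  refine integral_congr_ae (ae_of_all _ fun y => ?_)
  simp only
  rw [mul_assoc, ← Complex.exp_add, inner_sub_left, real_inner_comm, real_inner_comm ξ y]
  congr 2
  push_cast
  ring

/-- Reflecting and translating `f` produces precisely the kernel `e^{-i⟨ξ, φ⟩}` of the inverse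
transform, so no regularity of `f` is needed. -/
theorem LevyTriple.convolve_eq_fourierInv (L : LevyTriple d) (t : ℝ) (f : E d → ℂ) (φ : E d) :
    L.convolve t f φ =
      fourierInv (fun ξ => Complex.exp (t * L.symbolImag ξ) * fourier f ξ) φ := by
  rw [LevyTriple.convolve, LevyTriple.nu, fourierInv, ← integral_const_mul]
  refine integral_congr_ae (ae_of_all _ fun ξ => ?_)
  simp only [fourierInv_comp_sub]
  ring

/-- Convolution with `ν_t` is integration with respect to its law. -/
theorem LevyTriple.convolve_eq_integral (L : LevyTriple d) {t : ℝ} {μ : Measure (E d)}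
    [IsProbabilityMeasure μ] (hμ : ∀ η, laplace μ η = Complex.exp (t * L.symbol η))
    {f : E d → ℂ} (hc : Continuous f) (hi : Integrable f) (hf : Integrable (fourier f)) (φ : E d) :
    L.convolve t f φ = ∫ x, f (φ - x) ∂μ := by
  have hinv : ∀ x, f (φ - x) = (((2 * Real.pi) ^ d : ℝ) : ℂ)⁻¹ *
      ∫ ξ, fourier f ξ * Complex.exp (-Complex.I * (inner ℝ ξ (φ - x) : ℝ)) := fun x =>
    (congrFun (fourierInv_fourier hc hi hf) (φ - x)).symm
  simp_rw [hinv]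
  rw [integral_const_mul, L.convolve_eq_fourierInv, fourierInv]
  congr 1
  -- Fubini applies because `|ℱ(f)|` dominates the integrand and `μ` is finite.
  rw [integral_integral_swap]
  · refine integral_congr_ae (ae_of_all _ fun ξ => ?_)
    simp only [inner_sub_right]
    have h := hμ (fun k => -Complex.I * (ξ k : ℂ))
    rw [laplace_neg_I] at h
    rw [LevyTriple.symbolImag, ← h, mul_assoc, mul_comm, ← integral_const_mul]
    refine integral_congr_ae (ae_of_all _ fun x => ?_)
    simp only
    rw [mul_assoc, ← Complex.exp_add]
    congr 2
    push_cast
    ring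
  · have h1 : Integrable (fun p : E d × E d => (1 : ℂ) * fourier f p.2) (μ.prod volume) :=
      (integrable_const (1 : ℂ)).mul_prod hf
    refine h1.norm.mono' ?_ (ae_of_all _ fun p => ?_)
    · refine AEStronglyMeasurable.mul ?_ (by fun_prop)
      simpa using h1.aestronglyMeasurable
    · simp only [Function.uncurry]
      rw [norm_mul, norm_cexp_neg_I_mul_ofReal]
      simp

theorem integrable_prod_comp_sub {μ : Measure (E d)} [IsFiniteMeasure μ] {f : E d → ℂ}
    (hc : Continuous f) (hi : Integrable f) :
    Integrable (fun p : E d × E d => f (p.1 - p.2)) (volume.prod μ) := by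
  rw [integrable_prod_iff' (Continuous.aestronglyMeasurable (by fun_prop))]
  refine ⟨ae_of_all _ fun x => hi.comp_sub_right x, ?_⟩
  have h : ∀ x : E d, ∫ y, ‖f (y - x)‖ = ∫ y, ‖f y‖ := fun x =>
    integral_sub_right_eq_self (fun y => ‖f y‖) x
  simp only [h]
  exact integrable_const _

theorem fourier_integral_comp_sub {μ : Measure (E d)} [IsFiniteMeasure μ] {f : E d → ℂ}
    (hc : Continuous f) (hi : Integrable f) (ξ : E d) :
    fourier (fun φ => ∫ x, f (φ - x) ∂μ) ξ =
      (∫ x, Complex.exp (Complex.I * (inner ℝ ξ x : ℝ)) ∂μ) * fourier f ξ := by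
  rw [fourier]
  simp_rw [← integral_mul_const]
  rw [integral_integral_swap]
  · refine integral_congr_ae (ae_of_all _ fun x => ?_)
    have h := integral_sub_right_eq_self (μ := (volume : Measure (E d)))
      (fun y => f y * Complex.exp (Complex.I * (inner ℝ ξ (y + x) : ℝ))) x
    simp only [sub_add_cancel] at h
    simp only
    rw [h, fourier, ← integral_const_mul]
    refine integral_congr_ae (ae_of_all _ fun y => ?_)
    simp only
    rw [mul_left_comm, ← Complex.exp_add, inner_add_right]
    congr 2
    push_cast
    ring
  · refine (integrable_prod_comp_sub (μ := μ) hc hi).norm.mono'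
      (Continuous.aestronglyMeasurable (by fun_prop)) (ae_of_all _ fun p => ?_)
    simp only [Function.uncurry]
    rw [norm_mul, norm_cexp_I_mul_ofReal, mul_one]

/-! ### The Cauchy problem -/

theorem continuous_fourierInv {g : E d → ℂ} (hg : Integrable g) : Continuous (fourierInv g) := by
  unfold fourierInv
  refine continuous_const.mul ?_
  refine continuous_of_dominated (bound := fun ξ => ‖g ξ‖) (fun x => ?_) (fun x => ?_) hg.norm ?_
  · exact hg.aestronglyMeasurable.mul (by fun_prop)
  · refine ae_of_all _ fun ξ => ?_
    rw [norm_mul, norm_cexp_neg_I_mul_ofReal, mul_one]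
  · exact ae_of_all _ fun ξ => by fun_prop

theorem integrable_of_symbol_weight {g : E d → ℂ} (hg : Continuous g)
    (hg2 : Integrable fun ξ => (1 + ‖ξ‖ ^ 2) * ‖g ξ‖) : Integrable g := by
  refine hg2.mono' hg.aestronglyMeasurable (ae_of_all _ fun ξ => ?_)
  nlinarith [norm_nonneg (g ξ), mul_nonneg (sq_nonneg ‖ξ‖) (norm_nonneg (g ξ))]

theorem LevyTriple.integrable_symbolImag_mul (L : LevyTriple d) {g : E d → ℂ} (hg : Continuous g)
    (hg2 : Integrable fun ξ => (1 + ‖ξ‖ ^ 2) * ‖g ξ‖) :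
    Integrable fun ξ => L.symbolImag ξ * g ξ := by
  obtain ⟨C, hC0, hC⟩ := L.exists_norm_symbolImag_le
  refine (hg2.const_mul C).mono' (L.continuous_symbolImag.mul hg).aestronglyMeasurable
    (ae_of_all _ fun ξ => ?_)
  rw [norm_mul, ← mul_assoc]
  gcongr
  exact hC ξ

/-- Regularity of an initial condition which suffices for the Cauchy problem. -/
structure RegularInitial (f : E d → ℂ) : Prop where
  continuous : Continuous f
  integrable : Integrable f
  weight : Integrable fun ξ => (1 + ‖ξ‖ ^ 2) * ‖fourier f ξ‖

theorem RegularInitial.integrable_fourier {f : E d → ℂ} (hf : RegularInitial f) :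
    Integrable (fourier f) :=
  integrable_of_symbol_weight (continuous_fourier hf.integrable) hf.weight

theorem regularInitial_initial (hlam : lam.PosDef) {ζ : ℂ} (hζ : 0 < ζ.re) :
    RegularInitial (initial lam ζ) := by
  refine ⟨continuous_initial lam ζ, integrable_initial hlam hζ, ?_⟩
  obtain ⟨K, δ, hδ, h⟩ := exists_norm_fourier_initial_le hlam hζ
  have hδ2 : 0 < ((δ / 2 : ℝ) : ℂ).re := by simpa using hδ
  have hgauss := (GaussianFourier.integrable_cexp_neg_mul_sq_norm_add hδ2 0 (0 : E d)).norm
  refine (hgauss.const_mul ((1 + 2 / δ) * K)).mono' ?_ (ae_of_all _ fun ξ => ?_)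
  · exact Continuous.aestronglyMeasurable
      (Continuous.mul (by fun_prop) (continuous_fourier (integrable_initial hlam hζ)).norm)
  have hK : 0 ≤ K := by
    have := (norm_nonneg _).trans (h 0)
    simpa using this
  rw [Real.norm_of_nonneg (by positivity)]
  have h1 : ‖Complex.exp (-((δ / 2 : ℝ) : ℂ) * (‖ξ‖ : ℂ) ^ 2 + 0 * ((inner ℝ (0 : E d) ξ : ℝ) : ℂ))‖
      = Real.exp (-(δ / 2) * ‖ξ‖ ^ 2) := by
    rw [Complex.norm_exp]
    congr 1
    rw [zero_mul, add_zero, ← Complex.ofReal_pow, ← Complex.ofReal_neg, ← Complex.ofReal_mul,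
      Complex.ofReal_re]
  refine le_of_le_of_eq ?_ (congrArg (fun y => (1 + 2 / δ) * K * y) h1.symm)
  -- Half of the Gaussian decay is spent on the polynomial weight; the constant `1 + 2/δ` makes `e^y
  -- ≥ 1 + y` sufficient.
  have h2 : (1 + ‖ξ‖ ^ 2) ≤ (1 + 2 / δ) * Real.exp (δ / 2 * ‖ξ‖ ^ 2) := by
    have h3 := Real.add_one_le_exp (δ / 2 * ‖ξ‖ ^ 2)
    have h4 : (1 + 2 / δ) * (δ / 2 * ‖ξ‖ ^ 2 + 1) = 1 + ‖ξ‖ ^ 2 + (δ / 2 * ‖ξ‖ ^ 2 + 2 / δ) := by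
      field_simp
      ring
    have h5 : 0 ≤ δ / 2 * ‖ξ‖ ^ 2 + 2 / δ := by positivity
    calc (1 + ‖ξ‖ ^ 2) ≤ (1 + 2 / δ) * (δ / 2 * ‖ξ‖ ^ 2 + 1) := by linarith
      _ ≤ _ := by gcongr
  calc (1 + ‖ξ‖ ^ 2) * ‖fourier (initial lam ζ) ξ‖
      ≤ ((1 + 2 / δ) * Real.exp (δ / 2 * ‖ξ‖ ^ 2)) * (K * Real.exp (-δ * ‖ξ‖ ^ 2)) := by
        gcongr
        exact h ξ
    _ = (1 + 2 / δ) * K * (Real.exp (δ / 2 * ‖ξ‖ ^ 2) * Real.exp (-δ * ‖ξ‖ ^ 2)) := by ring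
    _ = _ := by
        rw [← Real.exp_add]
        congr 2
        ring

/-- Writing the convolution as an average of translates over the law allows Fubini; each translate
contributes a phase, and the phases integrate to the characteristic function. -/
theorem LevyTriple.fourier_convolve (L : LevyTriple d) (hr : IsCompact L.r.support) {t : ℝ}
    (ht : 0 ≤ t) {f : E d → ℂ} (hf : RegularInitial f) :
    fourier (L.convolve t f) = fun ξ => Complex.exp (t * L.symbolImag ξ) * fourier f ξ := by
  obtain ⟨μ, hμ, -, h⟩ := L.exists_law hr ht
  funext ξ
  rw [funext (L.convolve_eq_integral h hf.continuous hf.integrable hf.integrable_fourier),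
    fourier_integral_comp_sub hf.continuous hf.integrable, ← laplace_neg_I, h]
  rfl

theorem LevyTriple.integrable_convolve (L : LevyTriple d) (hr : IsCompact L.r.support) {t : ℝ}
    (ht : 0 ≤ t) {f : E d → ℂ} (hf : RegularInitial f) : Integrable (L.convolve t f) := by
  obtain ⟨μ, hμ, -, h⟩ := L.exists_law hr ht
  rw [funext (L.convolve_eq_integral h hf.continuous hf.integrable hf.integrable_fourier)]
  exact (integrable_prod_comp_sub (μ := μ) hf.continuous hf.integrable).integral_prod_left

/-- All clauses but integrability of `u_t` rest on `e^{tΨ(-iξ)} ℱ(f)(ξ)` and its modulus bound for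
`t ≥ 0`: `|ℱ(f)|` dominates the limits and `|Ψ(-iξ) ℱ(f)|` dominates the time derivative. -/
theorem LevyTriple.isCauchySolution_convolve (L : LevyTriple d) (hr : IsCompact L.r.support)
    {f : E d → ℂ} (hf : RegularInitial f) :
    L.IsCauchySolution f (fun t => L.convolve t f) := by
  have hcg := continuous_fourier hf.integrable
  have hcΨ := L.continuous_symbolImag
  have hgi := hf.integrable_fourier
  have hexp : ∀ t : ℝ, Continuous fun ξ => Complex.exp (t * L.symbolImag ξ) := fun t =>
    (continuous_const.mul hcΨ).cexp
  have hgt : ∀ t : ℝ, 0 ≤ t →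
      Integrable fun ξ => Complex.exp (t * L.symbolImag ξ) * fourier f ξ := fun t ht => by
    refine hgi.norm.mono' ((hexp t).mul hcg).aestronglyMeasurable (ae_of_all _ fun ξ => ?_)
    rw [norm_mul]
    exact mul_le_of_le_one_left (norm_nonneg _) (L.norm_exp_symbolImag_le_one hr ht ξ)
  have hΨg := L.integrable_symbolImag_mul hcg hf.weight
  have hconv : ∀ t, L.convolve t f =
      fourierInv (fun ξ => Complex.exp (t * L.symbolImag ξ) * fourier f ξ) := fun t =>
    funext (L.convolve_eq_fourierInv t f)
  have hFu : ∀ t : ℝ, 0 ≤ t → fourier (L.convolve t f) =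
      fun ξ => Complex.exp (t * L.symbolImag ξ) * fourier f ξ := fun t ht =>
    L.fourier_convolve hr ht hf
  refine ⟨fun t ht => ?_, fun t ht => L.integrable_convolve hr ht hf, fun t ht => ?_,
    fun t ht => ?_, ?_, fun φ => ?_, fun ξ => ?_, fun t ht φ => ?_, fun t ht ξ => ?_⟩
  · simp only [hconv]
    exact continuous_fourierInv (hgt t ht)
  · rw [hFu t ht]
    exact hgt t ht
  · rw [hFu t ht]
    refine hΨg.norm.mono' (hcΨ.mul ((hexp t).mul hcg)).aestronglyMeasurable
      (ae_of_all _ fun ξ => ?_)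
    rw [mul_left_comm, norm_mul]
    exact mul_le_of_le_one_left (norm_nonneg _) (L.norm_exp_symbolImag_le_one hr ht ξ)
  · simp only [hconv]
    simpa using fourierInv_fourier hf.continuous hf.integrable hgi
  · simp only [hconv]
    conv => rhs; rw [← fourierInv_fourier hf.continuous hf.integrable hgi]
    unfold fourierInv
    refine Tendsto.const_mul _ ?_
    refine tendsto_integral_filter_of_dominated_convergence (fun ξ => ‖fourier f ξ‖) ?_ ?_
      hgi.norm ?_
    · exact Eventually.of_forall fun t =>
        (((hexp t).mul hcg).mul (by fun_prop)).aestronglyMeasurable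
    · filter_upwards [self_mem_nhdsWithin] with t ht
      refine ae_of_all _ fun ξ => ?_
      rw [norm_mul, norm_cexp_neg_I_mul_ofReal, mul_one, norm_mul]
      exact mul_le_of_le_one_left (norm_nonneg _)
        (L.norm_exp_symbolImag_le_one hr (le_of_lt ht) ξ)
    · refine ae_of_all _ fun ξ => ?_
      have hcont : Continuous fun t : ℝ => Complex.exp (t * L.symbolImag ξ) * fourier f ξ *
          Complex.exp (-Complex.I * (inner ℝ ξ φ : ℝ)) := by fun_prop
      have := hcont.tendsto 0
      simp only [Complex.ofReal_zero, zero_mul, Complex.exp_zero, one_mul] at this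
      exact this.mono_left nhdsWithin_le_nhds
  · have hcont : Continuous fun t : ℝ => Complex.exp (t * L.symbolImag ξ) * fourier f ξ := by
      fun_prop
    have := hcont.tendsto 0
    simp only [Complex.ofReal_zero, zero_mul, Complex.exp_zero, one_mul] at this
    refine (this.mono_left nhdsWithin_le_nhds).congr' ?_
    filter_upwards [self_mem_nhdsWithin] with t ht
    rw [hFu t (le_of_lt ht)]
  · rw [LevyTriple.op, hFu t ht.le]
    simp only [hconv]
    unfold fourierInv
    refine HasDerivAt.const_mul _ ?_
    refine (hasDerivAt_integral_of_dominated_loc_of_deriv_le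
      (F := fun (s : ℝ) ξ => Complex.exp (s * L.symbolImag ξ) * fourier f ξ *
        Complex.exp (-Complex.I * (inner ℝ ξ φ : ℝ)))
      (F' := fun (s : ℝ) ξ => L.symbolImag ξ * (Complex.exp (s * L.symbolImag ξ) * fourier f ξ) *
        Complex.exp (-Complex.I * (inner ℝ ξ φ : ℝ)))
      (bound := fun ξ => ‖L.symbolImag ξ * fourier f ξ‖)
      -- The neighbourhood of `t` is the half line `s > 0`, where `|e^{sΨ(-iξ)}| ≤ 1` is available.
      (Ioi_mem_nhds ht) ?_ ?_ ?_ ?_ hΨg.norm ?_).2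
    · exact Eventually.of_forall fun s =>
        (((hexp s).mul hcg).mul (by fun_prop)).aestronglyMeasurable
    · refine (hgt t ht.le).norm.mono'
        (((hexp t).mul hcg).mul (by fun_prop)).aestronglyMeasurable (ae_of_all _ fun ξ => ?_)
      rw [norm_mul, norm_cexp_neg_I_mul_ofReal, mul_one]
    · exact ((hcΨ.mul ((hexp t).mul hcg)).mul (by fun_prop)).aestronglyMeasurable
    · refine ae_of_all _ fun ξ s hs => ?_
      rw [norm_mul, norm_cexp_neg_I_mul_ofReal, mul_one, mul_left_comm, norm_mul]
      exact mul_le_of_le_one_left (norm_nonneg _)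
        (L.norm_exp_symbolImag_le_one hr (le_of_lt hs) ξ)
    · refine ae_of_all _ fun ξ s _ => ?_
      refine HasDerivAt.mul_const ?_ _
      have h1 : HasDerivAt (fun s : ℝ => (s : ℂ) * L.symbolImag ξ) (1 * L.symbolImag ξ) s :=
        Complex.ofRealCLM.hasDerivAt.mul_const _
      convert h1.cexp.mul_const (fourier f ξ) using 1
      ring
  · have h1 : HasDerivAt (fun s : ℝ => (s : ℂ) * L.symbolImag ξ) (1 * L.symbolImag ξ) t :=
      Complex.ofRealCLM.hasDerivAt.mul_const _
    have h2 := h1.cexp.mul_const (fourier f ξ)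
    refine (h2.congr_of_eventuallyEq ?_).congr_deriv ?_
    · filter_upwards [Ioi_mem_nhds ht] with s hs
      rw [hFu s (le_of_lt hs)]
    · rw [hFu t ht.le]
      ring

/-- The integrating factor `e^{-tc}` makes the product constant on `(0, ∞)`. The equation says
nothing at `0`, so the constant is identified by the one-sided limit. -/
theorem eq_exp_of_hasDerivAt {y : ℝ → ℂ} {y₀ c : ℂ}
    (h : ∀ t, 0 < t → HasDerivAt y (c * y t) t) (h0 : Tendsto y (𝓝[>] 0) (𝓝 y₀)) {t : ℝ}
    (ht : 0 < t) : y t = Complex.exp (t * c) * y₀ := by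
  set w : ℝ → ℂ := fun t => Complex.exp (t * -c) * y t with hw
  have hwd : ∀ t, 0 < t → HasDerivAt w 0 t := fun t ht => by
    have h1 : HasDerivAt (fun s : ℝ => (s : ℂ) * -c) (1 * -c) t :=
      Complex.ofRealCLM.hasDerivAt.mul_const _
    refine (h1.cexp.mul (h t ht)).congr_deriv ?_
    ring
  have hconst : ∀ s, 0 < s → w s = w t := fun s hs =>
    (convex_Ioi (0 : ℝ)).is_const_of_fderivWithin_eq_zero
      (fun r hr => (hwd r hr).differentiableAt.differentiableWithinAt)
      (fun r hr => by
        rw [fderivWithin_of_isOpen isOpen_Ioi hr]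
        ext
        simp [(hwd r hr).deriv]) hs ht
  have hlim : Tendsto w (𝓝[>] 0) (𝓝 y₀) := by
    have hcont : Continuous fun s : ℝ => Complex.exp (s * -c) := by fun_prop
    have h1 := (hcont.tendsto 0).mono_left (nhdsWithin_le_nhds (s := Set.Ioi (0 : ℝ)))
    simpa [hw] using h1.mul h0
  have hlim2 : Tendsto w (𝓝[>] 0) (𝓝 (w t)) := by
    refine tendsto_const_nhds.congr' ?_
    filter_upwards [self_mem_nhdsWithin] with s hs
    exact (hconst s hs).symm
  have := tendsto_nhds_unique hlim2 hlim
  rw [← this, hw]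
  simp only
  rw [← mul_assoc, ← Complex.exp_add]
  simp

/-- At each frequency the transform solves a scalar linear equation with prescribed limit at `0`;
Fourier inversion then recovers `u t`. -/
theorem LevyTriple.IsCauchySolution.eq_convolve {L : LevyTriple d} {f : E d → ℂ}
    {u : ℝ → E d → ℂ} (hu : L.IsCauchySolution f u) {t : ℝ} (ht : 0 ≤ t) :
    u t = L.convolve t f := by
  have hF : fourier (u t) = fun ξ => Complex.exp (t * L.symbolImag ξ) * fourier f ξ := by
    funext ξ
    rcases ht.eq_or_lt with rfl | ht
    · simp [hu.initial_eq]
    · exact eq_exp_of_hasDerivAt (fun s hs => hu.fourier_hasDerivAt s hs ξ)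
        (hu.fourier_tendsto ξ) ht
  rw [← fourierInv_fourier (hu.continuous t ht) (hu.integrable t ht) (hu.integrable_fourier t ht),
    hF]
  exact (funext (L.convolve_eq_fourierInv t f)).symm

end

end LevyBorel

namespace LevyBorel

noncomputable section

/-! ### Borel summability of Laplace transforms of nonnegative random variables -/

/-- The entire function `∑ (-w)^m / (m!)² = J₀(2√w)`. -/
def bessel (w : ℂ) : ℂ := ∑' m : ℕ, (-w) ^ m / (m.factorial : ℂ) ^ 2

theorem norm_bessel_term_le (w : ℂ) (m : ℕ) :
    ‖(-w) ^ m / (m.factorial : ℂ) ^ 2‖ ≤ ‖w‖ ^ m / m.factorial := by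
  rw [norm_div, norm_pow, norm_neg, norm_pow, Complex.norm_natCast]
  gcongr
  have : (1 : ℝ) ≤ m.factorial := by exact_mod_cast m.factorial_pos
  nlinarith

theorem hasSum_bessel (w : ℂ) :
    HasSum (fun m : ℕ => (-w) ^ m / (m.factorial : ℂ) ^ 2) (bessel w) :=
  (Summable.of_norm_bounded (Real.summable_pow_div_factorial ‖w‖)
    (norm_bessel_term_le w)).hasSum

theorem differentiable_bessel : Differentiable ℂ bessel := by
  intro w
  have h : DifferentiableOn ℂ bessel (Metric.ball 0 (‖w‖ + 1)) := by
    refine Complex.differentiableOn_tsum_of_summable_norm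
      (Real.summable_pow_div_factorial (‖w‖ + 1)) (fun m => ?_) Metric.isOpen_ball
      (fun m z hz => (norm_bessel_term_le z m).trans ?_)
    · exact (Differentiable.div_const (by fun_prop) _).differentiableOn
    · have : ‖z‖ ≤ ‖w‖ + 1 := by simpa using (mem_ball_zero_iff.1 hz).le
      gcongr
  exact h.differentiableAt (Metric.isOpen_ball.mem_nhds (by simp))

theorem wallis_prod_mul (n : ℕ) :
    (∏ i ∈ Finset.range n, (2 * (i : ℝ) + 1) / (2 * i + 2)) * 4 ^ n / (2 * n).factorial =
      1 / (n.factorial : ℝ) ^ 2 := by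
  induction n with
  | zero => simp
  | succ n ih =>
    rw [Finset.prod_range_succ, show 2 * (n + 1) = 2 * n + 1 + 1 by ring, Nat.factorial_succ,
      Nat.factorial_succ, Nat.factorial_succ, pow_succ]
    rw [div_eq_div_iff (by positivity) (by positivity)] at ih ⊢
    push_cast
    have h : (2 * (n : ℝ) + 2) ≠ 0 := by positivity
    rw [mul_div_assoc', div_mul_eq_mul_div, div_mul_eq_mul_div, div_eq_iff h]
    linear_combination (4 * ((n : ℝ) + 1) ^ 2 * (2 * n + 1)) * ih

/-- This is Poisson's integral for `J₀(2s)`: integrate the cosine series term by term, the even sine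
moments being the Wallis products of `wallis_prod_mul`. Unlike the power series, it shows that
growth is governed by `Im s` alone. -/
theorem bessel_sq (s : ℂ) :
    bessel (s ^ 2) = (Real.pi : ℂ)⁻¹ * ∫ θ in (0 : ℝ)..Real.pi,
      Complex.cos (2 * s * (Real.sin θ : ℂ)) := by
  have h1 : HasSum (fun n : ℕ => ∫ θ in (0 : ℝ)..Real.pi,
      (-1) ^ n * (2 * s * (Real.sin θ : ℂ)) ^ (2 * n) / ((2 * n).factorial : ℂ))
      (∫ θ in (0 : ℝ)..Real.pi, Complex.cos (2 * s * (Real.sin θ : ℂ))) := by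
    refine intervalIntegral.hasSum_integral_of_dominated_convergence
      (fun n _ => (2 * ‖s‖) ^ (2 * n) / ((2 * n).factorial : ℝ)) (fun n => ?_) (fun n => ?_) ?_ ?_ ?_
    · exact Continuous.aestronglyMeasurable (by fun_prop)
    · refine ae_of_all _ fun θ _ => ?_
      rw [norm_div, norm_mul, norm_pow, norm_neg, norm_one, one_pow, one_mul, norm_pow, norm_mul,
        norm_mul, Complex.norm_ofNat, Complex.norm_natCast, Complex.norm_real]
      refine div_le_div_of_nonneg_right (pow_le_pow_left₀ (by positivity) ?_ _) (by positivity)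
      exact mul_le_of_le_one_right (by positivity) (Real.abs_sin_le_one θ)
    · refine ae_of_all _ fun θ _ => ?_
      exact (Real.summable_pow_div_factorial (2 * ‖s‖)).comp_injective
        (i := fun n : ℕ => 2 * n) (fun a b h => by simpa using h)
    · simp
    · exact ae_of_all _ fun θ _ => Complex.hasSum_cos _
  have h2 := (h1.mul_left (Real.pi : ℂ)⁻¹)
  refine (hasSum_bessel (s ^ 2)).unique (h2.congr_fun fun n => ?_)
  have h3 : ∀ θ : ℝ, (-1 : ℂ) ^ n * (2 * s * (Real.sin θ : ℂ)) ^ (2 * n) / ((2 * n).factorial : ℂ)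
      = ((-1 : ℂ) ^ n * (4 * s ^ 2) ^ n / ((2 * n).factorial : ℂ)) *
        ((Real.sin θ ^ (2 * n) : ℝ) : ℂ) := fun θ => by
    push_cast
    rw [mul_pow, pow_mul (2 * s), mul_pow 2 s 2]
    ring
  simp_rw [h3]
  rw [intervalIntegral.integral_const_mul, intervalIntegral.integral_ofReal,
    integral_sin_pow_even]
  have h4 := congrArg (Complex.ofReal) (wallis_prod_mul n)
  have hpi : (Real.pi : ℂ) ≠ 0 := by exact_mod_cast Real.pi_ne_zero
  simp only [Complex.ofReal_div, Complex.ofReal_mul, Complex.ofReal_pow, Complex.ofReal_natCast,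
    Complex.ofReal_one, Complex.ofReal_ofNat] at h4 ⊢
  rw [mul_pow 4 (s ^ 2) n, neg_pow (s ^ 2) n]
  have hpi' := inv_mul_cancel₀ hpi
  linear_combination (-((-1 : ℂ) ^ n * (s ^ 2) ^ n)) * h4 - (((-1 : ℂ) ^ n * (s ^ 2) ^ n) *
    (((∏ i ∈ Finset.range n, (2 * (i : ℝ) + 1) / (2 * i + 2) : ℝ) : ℂ) * 4 ^ n /
      ((2 * n).factorial : ℂ))) * hpi'

theorem norm_cos_le (z : ℂ) : ‖Complex.cos z‖ ≤ Real.exp |z.im| := by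
  rw [Complex.cos, norm_div, Complex.norm_ofNat, div_le_iff₀ (by norm_num)]
  refine (norm_add_le _ _).trans ?_
  rw [Complex.norm_exp, Complex.norm_exp]
  have h1 : (z * Complex.I).re = -z.im := by simp
  have h2 : (-z * Complex.I).re = z.im := by simp
  rw [h1, h2]
  have h3 : Real.exp (-z.im) ≤ Real.exp |z.im| := Real.exp_le_exp.2 (neg_le_abs _)
  have h4 : Real.exp z.im ≤ Real.exp |z.im| := Real.exp_le_exp.2 (le_abs_self _)
  linarith

theorem norm_bessel_sq_le (s : ℂ) : ‖bessel (s ^ 2)‖ ≤ Real.exp (2 * |s.im|) := by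
  rw [bessel_sq, norm_mul, norm_inv, Complex.norm_real, Real.norm_of_nonneg Real.pi_pos.le,
    inv_mul_le_iff₀ Real.pi_pos]
  have := intervalIntegral.norm_integral_le_of_norm_le_const (a := 0) (b := Real.pi)
    (f := fun θ : ℝ => Complex.cos (2 * s * (Real.sin θ : ℂ))) (C := Real.exp (2 * |s.im|))
    (fun θ _ => (norm_cos_le _).trans (Real.exp_le_exp.2 ?_))
  · rwa [sub_zero, abs_of_pos Real.pi_pos, mul_comm (Real.exp _)] at this
  · have h1 : (2 * s * (Real.sin θ : ℂ)).im = 2 * s.im * Real.sin θ := by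
      rw [Complex.im_mul_ofReal]
      simp
    rw [h1, abs_mul, abs_mul, abs_two]
    exact mul_le_of_le_one_right (by positivity) (Real.abs_sin_le_one θ)

theorem norm_bessel_ofReal_le {x : ℝ} (hx : 0 ≤ x) : ‖bessel x‖ ≤ 1 := by
  have := norm_bessel_sq_le (√x : ℝ)
  rwa [← Complex.ofReal_pow, Real.sq_sqrt hx, Complex.ofReal_im, abs_zero, mul_zero,
    Real.exp_zero] at this

/-- For `τ = r²` one has `|τ| - Re τ = 2(Im r)²`. A point `x ≥ 0` within `1/4` of `τ` gives `|τ| < x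
+ 1/4` and `Re τ > x - 1/4`, so this difference is below `1/2`. -/
theorem exists_sq_eq_of_mem_strip {τ : ℂ} (hτ : τ ∈ strip 4) : ∃ r : ℂ, r ^ 2 = τ ∧ |r.im| ≤ 1 / 2 := by
  obtain ⟨r, hr⟩ := IsAlgClosed.exists_pow_nat_eq τ (n := 2) (by norm_num)
  refine ⟨r, hr, ?_⟩
  have hne : ((fun x : ℝ => (x : ℂ)) '' Set.Ici 0).Nonempty := ⟨_, 0, Set.self_mem_Ici, rfl⟩
  obtain ⟨_, ⟨x, hx, rfl⟩, hd⟩ := (Metric.infDist_lt_iff hne).1 hτ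
  simp only [Set.mem_Ici] at hx
  rw [dist_eq_norm] at hd
  have h1 : ‖τ‖ < x + 1 / 4 := by
    have := norm_add_le (τ - x) x
    rw [sub_add_cancel, Complex.norm_real, Real.norm_of_nonneg hx] at this
    linarith
  have h2 : x - 1 / 4 < τ.re := by
    have := (abs_le.1 (Complex.abs_re_le_norm (τ - x))).1
    simp only [Complex.sub_re, Complex.ofReal_re] at this
    linarith
  have h3 : ‖τ‖ = r.re ^ 2 + r.im ^ 2 := by
    rw [← hr, norm_pow, ← Complex.normSq_eq_norm_sq, Complex.normSq_apply]
    ring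
  have h4 : τ.re = r.re ^ 2 - r.im ^ 2 := by
    rw [← hr, sq, Complex.mul_re]
    ring
  refine abs_le_of_sq_le_sq ?_ (by norm_num)
  nlinarith

/-- With `τ = r²` the argument is `(r√x)²`, and `2|Im r|√x ≤ √x`. The bound is uniform in `τ`, so a
finite `E e^{√W}` suffices on the whole strip. -/
theorem norm_bessel_mul_le {τ : ℂ} (hτ : τ ∈ strip 4) {x : ℝ} (hx : 0 ≤ x) :
    ‖bessel (τ * x)‖ ≤ Real.exp (√x) := by
  obtain ⟨r, rfl, hr⟩ := exists_sq_eq_of_mem_strip hτ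
  have h1 : r ^ 2 * x = (r * (√x : ℝ)) ^ 2 := by
    rw [mul_pow, ← Complex.ofReal_pow, Real.sq_sqrt hx]
  rw [h1]
  refine (norm_bessel_sq_le _).trans (Real.exp_le_exp.2 ?_)
  rw [Complex.im_mul_ofReal, abs_mul, abs_of_nonneg (Real.sqrt_nonneg x)]
  nlinarith [Real.sqrt_nonneg x]

theorem isOpen_strip (σ : ℝ) : IsOpen (strip σ) :=
  isOpen_lt (Metric.continuous_infDist_pt _) continuous_const

/-- Taylor remainder of the exponential in the left half plane. -/
theorem norm_exp_sub_sum_le {w : ℂ} (hw : 0 ≤ w.re) (N : ℕ) :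
    ‖Complex.exp (-w) - ∑ m ∈ Finset.range N, (-w) ^ m / (m.factorial : ℂ)‖ ≤
      ‖w‖ ^ N / N.factorial := by
  -- Along the segment `s ↦ sw`, the derivative of each remainder is `-w` times the previous one.
  -- Induction on `N` therefore compares derivatives and integrates from `s = 0`.
  suffices h : ∀ N : ℕ, ∀ s ∈ Set.Icc (0 : ℝ) 1, ‖Complex.exp (s * -w) -
      ∑ m ∈ Finset.range N, (s * -w) ^ m / (m.factorial : ℂ)‖ ≤ (s * ‖w‖) ^ N / N.factorial by
    simpa using h N 1 (by simp)
  intro N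
  induction N with
  | zero =>
    intro s hs
    simp only [Finset.range_zero, Finset.sum_empty, sub_zero, pow_zero, Nat.factorial_zero,
      Nat.cast_one, div_one, Complex.norm_exp, Real.exp_le_one_iff, Complex.re_ofReal_mul,
      Complex.neg_re]
    have := mul_nonneg hs.1 hw
    linarith
  | succ N ih =>
    have hlin : ∀ s : ℝ, HasDerivAt (fun s : ℝ => (s : ℂ) * -w) (-w) s := fun s => by
      simpa using (Complex.ofRealCLM.hasDerivAt (x := s)).mul_const (-w)
    have hd : ∀ s : ℝ, HasDerivAt (fun s : ℝ => Complex.exp (s * -w) -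
        ∑ m ∈ Finset.range (N + 1), (s * -w) ^ m / (m.factorial : ℂ))
        ((Complex.exp (s * -w) - ∑ m ∈ Finset.range N, (s * -w) ^ m / (m.factorial : ℂ)) * -w)
        s := fun s => by
      have h1 : HasDerivAt (fun s : ℝ =>
          ∑ m ∈ Finset.range (N + 1), ((s : ℂ) * -w) ^ m / (m.factorial : ℂ))
          (∑ m ∈ Finset.range (N + 1), (m : ℂ) * ((s : ℂ) * -w) ^ (m - 1) * -w / (m.factorial : ℂ))
          s := HasDerivAt.fun_sum fun m _ => ((hlin s).fun_pow m).div_const _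
      refine ((hlin s).cexp.sub h1).congr_deriv ?_
      rw [Finset.sum_range_succ', sub_mul, Finset.sum_mul]
      simp only [Nat.cast_zero, zero_mul, zero_div, add_zero, Nat.add_sub_cancel]
      congr 1
      refine Finset.sum_congr rfl fun m _ => ?_
      rw [Nat.factorial_succ]
      have : (m.factorial : ℂ) ≠ 0 := by exact_mod_cast m.factorial_ne_zero
      have : (m : ℂ) + 1 ≠ 0 := by exact_mod_cast Nat.succ_ne_zero m
      push_cast
      field_simp
    have hB : ∀ s : ℝ, HasDerivAt (fun s : ℝ => (s * ‖w‖) ^ (N + 1) / ((N + 1).factorial : ℝ))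
        ((s * ‖w‖) ^ N / N.factorial * ‖w‖) s := fun s => by
      have h1 : HasDerivAt (fun s : ℝ => s * ‖w‖) ‖w‖ s := by
        simpa using (hasDerivAt_id s).mul_const ‖w‖
      refine ((h1.fun_pow (N + 1)).div_const _).congr_deriv ?_
      rw [Nat.factorial_succ]
      push_cast
      field_simp
    intro s hs
    refine image_norm_le_of_norm_deriv_right_le_deriv_boundary
      (fun x _ => (hd x).continuousAt.continuousWithinAt)
      (fun x _ => (hd x).hasDerivWithinAt) ?_ hB ?_ hs
    · simp [Finset.sum_range_succ']
    · intro x hx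
      rw [norm_mul, norm_neg]
      gcongr
      exact ih x ⟨hx.1, hx.2.le⟩

theorem circleRegion_subset {R : ℝ} (hR : 0 < R) : circleRegion R ⊆ {ζ : ℂ | 0 < ζ.re} := by
  intro ζ hζ
  have h1 : 0 < (ζ⁻¹).re := (inv_pos.2 hR).trans hζ
  rw [Complex.inv_re] at h1
  exact (pos_iff_pos_of_mul_pos (a := ζ.re) (b := (Complex.normSq ζ)⁻¹)
    (by rwa [div_eq_mul_inv] at h1)).2 (by
      -- The point `ζ = 0` is excluded by `h1`, since division by zero gives zero.
      rcases (Complex.normSq_nonneg ζ).eq_or_lt with h | h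
      · rw [← h] at h1; simp at h1
      · exact inv_pos.2 h)

/-! ### Nonnegative random variables with finite expectation of `e^{√W}` -/

variable {Ω : Type*} [MeasurableSpace Ω] {P : Measure Ω} {W : Ω → ℝ}

/-- Averages of an entire function over dilations are holomorphic. -/
theorem differentiableOn_integral_comp_mul {H : ℂ → ℂ} (hH : Differentiable ℂ H) {U : Set ℂ}
    (hU : IsOpen U) (hW : Measurable W) {b : Ω → ℝ} (hb : Integrable b P)
    (hle : ∀ τ ∈ U, ∀ ω, ‖H (τ * W ω)‖ ≤ b ω) :
    DifferentiableOn ℂ (fun τ => ∫ ω, H (τ * W ω) ∂P) U := by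
  intro τ₀ hτ₀
  obtain ⟨ε, hε, hball⟩ := Metric.isOpen_iff.1 hU τ₀ hτ₀
  have hmeas : ∀ τ : ℂ, AEStronglyMeasurable (fun ω => H (τ * W ω)) P := fun τ =>
    (hH.continuous.measurable.comp (by fun_prop)).aestronglyMeasurable
  have hdiff : ∀ ω τ, HasDerivAt (fun τ : ℂ => H (τ * W ω)) (deriv H (τ * W ω) * W ω) τ :=
    fun ω τ => by
      have h1 : HasDerivAt (fun τ : ℂ => τ * (W ω : ℂ)) (W ω : ℂ) τ := by
        simpa using (hasDerivAt_id τ).mul_const (W ω : ℂ)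
      exact (hH (τ * W ω)).hasDerivAt.comp τ h1
  have hH' : Continuous (deriv H) := (hH.contDiff (n := 1)).continuous_deriv le_rfl
  refine (hasDerivAt_integral_of_dominated_loc_of_deriv_le
    (F := fun (τ : ℂ) ω => H (τ * W ω)) (F' := fun τ ω => deriv H (τ * W ω) * W ω)
    (bound := fun ω => b ω / (ε / 2))
    (Metric.ball_mem_nhds τ₀ (half_pos hε)) (Eventually.of_forall hmeas)
    (hb.mono' (hmeas τ₀) (ae_of_all _ (hle τ₀ hτ₀))) ?_ ?_ (hb.div_const _)
    (ae_of_all _ fun ω τ _ => hdiff ω τ)).2.differentiableAt.differentiableWithinAt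
  · exact (((hH'.measurable.comp (by fun_prop)).mul (by fun_prop))).aestronglyMeasurable
  · refine ae_of_all _ fun ω τ hτ => ?_
    rw [← (hdiff ω τ).deriv]
    -- Cauchy's estimate on circles of radius `ε/2`, which stay in `U`, derives the bound on the
    -- derivative from the bound `b` on `H` itself.
    refine Complex.norm_deriv_le_of_forall_mem_sphere_norm_le (half_pos hε) ?_ fun z hz => ?_
    · exact (show Differentiable ℂ fun τ : ℂ => H (τ * W ω) from
        fun τ => (hdiff ω τ).differentiableAt).diffContOnCl
    · refine hle z (hball ?_) ω
      rw [Metric.mem_ball] at hτ ⊢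
      rw [Metric.mem_sphere] at hz
      linarith [dist_triangle z τ τ₀]

theorem factorial_two_mul_le (N : ℕ) :
    ((2 * N).factorial : ℝ) ≤ 4 ^ N * (N.factorial : ℝ) ^ 2 := by
  have h1 := Nat.choose_mul_factorial_mul_factorial (show N ≤ 2 * N by omega)
  rw [show 2 * N - N = N by omega] at h1
  have h2 : (2 * N).choose N ≤ 4 ^ N := by
    have := Nat.choose_le_two_pow (2 * N) N
    rwa [pow_mul] at this
  calc ((2 * N).factorial : ℝ) = ((2 * N).choose N : ℝ) * N.factorial * N.factorial := by
        exact_mod_cast h1.symm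
    _ ≤ 4 ^ N * N.factorial * N.factorial := by
        gcongr
        exact_mod_cast h2
    _ = _ := by ring

/-- Keep only the term of index `2N` in the series of `e^{√x}` and use `(2N)! ≤ 4^N (N!)²`. This is
where `σ = 4` in the Watson bound comes from. -/
theorem pow_le_factorial_mul_exp_sqrt {x : ℝ} (hx : 0 ≤ x) (N : ℕ) :
    x ^ N ≤ 4 ^ N * (N.factorial : ℝ) ^ 2 * Real.exp (√x) := by
  have h1 : (√x) ^ (2 * N) / (2 * N).factorial ≤ Real.exp (√x) :=
    Real.pow_div_factorial_le_exp _ (Real.sqrt_nonneg x) _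
  rw [pow_mul, Real.sq_sqrt hx, div_le_iff₀ (by positivity), mul_comm] at h1
  refine h1.trans ?_
  gcongr
  exact factorial_two_mul_le N

theorem integrable_pow_of_exp_sqrt (hW : Measurable W) (hW0 : ∀ ω, 0 ≤ W ω)
    (hexp : Integrable (fun ω => Real.exp (√(W ω))) P) (N : ℕ) :
    Integrable (fun ω => W ω ^ N) P := by
  refine (hexp.const_mul (4 ^ N * (N.factorial : ℝ) ^ 2)).mono'
    (by fun_prop) (ae_of_all _ fun ω => ?_)
  rw [Real.norm_of_nonneg (pow_nonneg (hW0 ω) N)]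
  exact pow_le_factorial_mul_exp_sqrt (hW0 ω) N

theorem integral_pow_le_of_exp_sqrt (hW : Measurable W) (hW0 : ∀ ω, 0 ≤ W ω)
    (hexp : Integrable (fun ω => Real.exp (√(W ω))) P) (N : ℕ) :
    ∫ ω, W ω ^ N ∂P ≤ 4 ^ N * (N.factorial : ℝ) ^ 2 * ∫ ω, Real.exp (√(W ω)) ∂P := by
  rw [← integral_const_mul]
  exact integral_mono (integrable_pow_of_exp_sqrt hW hW0 hexp N) (hexp.const_mul _)
    fun ω => pow_le_factorial_mul_exp_sqrt (hW0 ω) N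

/-- Watson's hypotheses for the Laplace transform of a nonnegative random variable. -/
theorem watsonSokal_laplace [IsProbabilityMeasure P] (hW : Measurable W) (hW0 : ∀ ω, 0 ≤ W ω)
    (hexp : Integrable (fun ω => Real.exp (√(W ω))) P) {h : ℂ → ℂ}
    (hh : ∀ ζ : ℂ, 0 < ζ.re → h ζ = ∫ ω, Complex.exp (-(ζ * W ω)) ∂P) {R : ℝ} (hR : 0 < R) :
    WatsonSokal h (fun m => (-1) ^ m / (m.factorial : ℂ) * ((∫ ω, W ω ^ m ∂P : ℝ) : ℂ)) R
      (∫ ω, Real.exp (√(W ω)) ∂P) 4 := by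
  have hopen : IsOpen {ζ : ℂ | 0 < ζ.re} := isOpen_lt continuous_const Complex.continuous_re
  have hre : ∀ ζ : ℂ, ∀ ω, (ζ * W ω).re = ζ.re * W ω := fun ζ ω => Complex.re_mul_ofReal _ _
  have hone : ∀ ζ ∈ {ζ : ℂ | 0 < ζ.re}, ∀ ω, ‖Complex.exp (-(ζ * W ω))‖ ≤ 1 := fun ζ hζ ω => by
    rw [Complex.norm_exp, Complex.neg_re, hre, Real.exp_le_one_iff]
    exact neg_nonpos.2 (mul_nonneg (le_of_lt hζ) (hW0 ω))
  refine ⟨?_, fun N ζ hζ => ?_⟩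
  · have h1 : DifferentiableOn ℂ (fun ζ : ℂ => ∫ ω, Complex.exp (-(ζ * W ω)) ∂P)
        {ζ : ℂ | 0 < ζ.re} :=
      differentiableOn_integral_comp_mul (H := fun z => Complex.exp (-z)) (by fun_prop) hopen hW
        (integrable_const (1 : ℝ)) hone
    exact ((h1.congr fun ζ hζ => hh ζ hζ).analyticOnNhd hopen).mono (circleRegion_subset hR)
  · have hζ' : 0 < ζ.re := circleRegion_subset hR hζ
    have hint : ∀ m, Integrable (fun ω => (-(ζ * W ω)) ^ m / (m.factorial : ℂ)) P := fun m => by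
      refine (((integrable_pow_of_exp_sqrt hW hW0 hexp m).ofReal (𝕜 := ℂ)).const_mul
        ((-ζ) ^ m / (m.factorial : ℂ))).congr (ae_of_all _ fun ω => ?_)
      simp only [Complex.coe_algebraMap, Complex.ofReal_pow]
      rw [← neg_mul, mul_pow]
      ring
    have hinte : Integrable (fun ω => Complex.exp (-(ζ * W ω))) P :=
      (integrable_const (1 : ℝ)).mono' (Measurable.aestronglyMeasurable (by fun_prop))
        (ae_of_all _ (hone ζ hζ'))
    have hsum : ∑ m ∈ Finset.range N, (-1) ^ m / (m.factorial : ℂ) *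
        ((∫ ω, W ω ^ m ∂P : ℝ) : ℂ) * ζ ^ m =
        ∫ ω, ∑ m ∈ Finset.range N, (-(ζ * W ω)) ^ m / (m.factorial : ℂ) ∂P := by
      rw [integral_finsetSum _ fun m _ => hint m]
      refine Finset.sum_congr rfl fun m _ => ?_
      rw [← integral_complex_ofReal, ← integral_const_mul, ← integral_mul_const]
      refine integral_congr_ae (ae_of_all _ fun ω => ?_)
      simp only [Complex.ofReal_pow]
      rw [← neg_mul, mul_pow, neg_pow]
      ring
    rw [hsum, hh ζ hζ', ← integral_sub hinte (integrable_finsetSum _ fun m _ => hint m)]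
    have hN : (N.factorial : ℝ) ≠ 0 := by positivity
    -- The `1/N!` of the Taylor remainder cancels one of the two factorials in the moment bound.
    calc _ ≤ ∫ ω, ‖ζ‖ ^ N / N.factorial * W ω ^ N ∂P := by
          refine norm_integral_le_of_norm_le
            ((integrable_pow_of_exp_sqrt hW hW0 hexp N).const_mul _) (ae_of_all _ fun ω => ?_)
          refine (norm_exp_sub_sum_le (by
            rw [hre]; exact mul_nonneg hζ'.le (hW0 ω)) N).trans (le_of_eq ?_)
          rw [norm_mul, Complex.norm_real, Real.norm_of_nonneg (hW0 ω), mul_pow]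
          ring
      _ ≤ ‖ζ‖ ^ N / N.factorial *
          (4 ^ N * (N.factorial : ℝ) ^ 2 * ∫ ω, Real.exp (√(W ω)) ∂P) := by
          rw [integral_const_mul]
          gcongr
          exact integral_pow_le_of_exp_sqrt hW hW0 hexp N
      _ = _ := by
          field_simp

theorem integral_pow_mul_exp_neg (m : ℕ) :
    IntegrableOn (fun x : ℝ => Real.exp (-x) * x ^ m) (Set.Ioi 0) ∧
      ∫ x in Set.Ioi (0 : ℝ), Real.exp (-x) * x ^ m = m.factorial := by
  have h1 := Real.GammaIntegral_convergent (s := (m : ℝ) + 1) (by positivity)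
  have h2 := Real.Gamma_eq_integral (s := (m : ℝ) + 1) (by positivity)
  simp only [add_sub_cancel_right, Real.rpow_natCast] at h1 h2
  exact ⟨h1, by rw [← h2, Real.Gamma_nat_eq_factorial]⟩

/-- Termwise, `∫ e^{-τ} τ^m dτ = m!` removes one of the two factorials. The absolute values sum to
the convergent series of `e^x`. -/
theorem integral_exp_neg_mul_bessel {x : ℝ} (hx : 0 ≤ x) :
    ∫ τ in Set.Ioi (0 : ℝ), Complex.exp (-(τ : ℂ)) * bessel (τ * x) = Complex.exp (-x) := by
  have hterm : ∀ (m : ℕ) (τ : ℝ), Complex.exp (-(τ : ℂ)) * ((-(τ * x : ℂ)) ^ m /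
      (m.factorial : ℂ) ^ 2) = ((-x : ℂ) ^ m / (m.factorial : ℂ) ^ 2) *
        ((Real.exp (-τ) * τ ^ m : ℝ) : ℂ) := fun m τ => by
    push_cast
    rw [← mul_neg, mul_pow]
    ring
  have h := hasSum_integral_of_summable_integral_norm
    (μ := volume.restrict (Set.Ioi (0 : ℝ)))
    (F := fun (m : ℕ) (τ : ℝ) => Complex.exp (-(τ : ℂ)) * ((-(τ * x : ℂ)) ^ m /
      (m.factorial : ℂ) ^ 2)) (fun m => ?_) ?_
  · have h2 : ∀ τ : ℝ, ∑' m : ℕ, Complex.exp (-(τ : ℂ)) * ((-(τ * x : ℂ)) ^ m /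
        (m.factorial : ℂ) ^ 2) = Complex.exp (-(τ : ℂ)) * bessel (τ * x) := fun τ =>
      ((hasSum_bessel (τ * x)).mul_left _).tsum_eq
    simp only [h2] at h
    refine h.unique ?_
    have h3 : HasSum (fun m : ℕ => (-x : ℂ) ^ m / (m.factorial : ℂ)) (Complex.exp (-x)) := by
      rw [Complex.exp_eq_exp_ℂ]
      exact NormedSpace.expSeries_div_hasSum_exp _
    refine h3.congr_fun fun m => ?_
    simp only [hterm]
    rw [integral_const_mul, integral_complex_ofReal, (integral_pow_mul_exp_neg m).2]
    have : (m.factorial : ℂ) ≠ 0 := by exact_mod_cast m.factorial_ne_zero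
    push_cast
    field_simp
  · simp only [hterm]
    exact ((integral_pow_mul_exp_neg m).1.ofReal (𝕜 := ℂ)).const_mul _
  · refine (Real.summable_pow_div_factorial x).congr fun m => ?_
    simp only [hterm, norm_mul, norm_div, norm_pow, norm_neg, Complex.norm_natCast,
      Complex.norm_real, Real.norm_of_nonneg hx]
    rw [integral_const_mul]
    have h3 : ∫ τ in Set.Ioi (0 : ℝ), ‖Real.exp (-τ)‖ * ‖τ‖ ^ m = m.factorial := by
      rw [← (integral_pow_mul_exp_neg m).2]
      refine setIntegral_congr_fun measurableSet_Ioi fun τ hτ => ?_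
      simp only [Real.norm_eq_abs, Real.abs_exp, abs_of_pos (Set.mem_Ioi.1 hτ)]
    rw [h3]
    field_simp

/-- The Borel transform of the Laplace transform of a nonnegative random variable. -/
theorem exists_borel_laplace [IsProbabilityMeasure P] (hW : Measurable W) (hW0 : ∀ ω, 0 ≤ W ω)
    (hexp : Integrable (fun ω => Real.exp (√(W ω))) P) :
    ∃ B : ℂ → ℂ, AnalyticOnNhd ℂ B (strip 4) ∧
      (∀ τ : ℂ, ‖τ‖ < 1 / 4 → HasSum (fun m : ℕ => (-τ) ^ m / (m.factorial : ℂ) ^ 2 *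
        ((∫ ω, W ω ^ m ∂P : ℝ) : ℂ)) (B τ)) ∧
      IntegrableOn (fun τ : ℝ => Complex.exp (-(τ : ℂ)) * B (τ : ℂ)) (Set.Ioi 0) ∧
      ∫ ω, Complex.exp (-(W ω : ℂ)) ∂P =
        ∫ τ in Set.Ioi (0 : ℝ), Complex.exp (-(τ : ℂ)) * B (τ : ℂ) := by
  have hcb := differentiable_bessel.continuous
  -- The averaged Bessel function is defined on the whole strip at once, so the continuation is
  -- built in and only its power series on the disc needs proof.
  refine ⟨fun τ => ∫ ω, bessel (τ * W ω) ∂P, ?_, fun τ hτ => ?_, ?_⟩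
  · exact (differentiableOn_integral_comp_mul differentiable_bessel (isOpen_strip 4) hW hexp
      fun τ hτ ω => norm_bessel_mul_le hτ (hW0 ω)).analyticOnNhd (isOpen_strip 4)
  · set M := ∫ ω, Real.exp (√(W ω)) ∂P with hM
    have hM0 : 0 ≤ M := integral_nonneg fun ω => (Real.exp_pos _).le
    have hterm : ∀ (m : ℕ) (ω : Ω), (-(τ * W ω)) ^ m / (m.factorial : ℂ) ^ 2 =
        (-τ) ^ m / (m.factorial : ℂ) ^ 2 * ((W ω ^ m : ℝ) : ℂ) := fun m ω => by
      push_cast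
      rw [← neg_mul, mul_pow]
      ring
    have h := hasSum_integral_of_summable_integral_norm (μ := P)
      (F := fun (m : ℕ) (ω : Ω) => (-(τ * W ω)) ^ m / (m.factorial : ℂ) ^ 2) (fun m => ?_) ?_
    · have h2 : ∀ ω, ∑' m : ℕ, (-(τ * W ω)) ^ m / (m.factorial : ℂ) ^ 2 = bessel (τ * W ω) :=
        fun ω => rfl
      simp only [h2] at h
      refine h.congr_fun fun m => ?_
      simp only [hterm]
      rw [integral_const_mul, integral_complex_ofReal]
    · simp only [hterm]
      exact ((integrable_pow_of_exp_sqrt hW hW0 hexp m).ofReal (𝕜 := ℂ)).const_mul _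
    · have h4 : ‖τ‖ * 4 < 1 := by linarith
      refine Summable.of_nonneg_of_le (fun m => integral_nonneg fun ω => norm_nonneg _)
        (fun m => ?_) ((summable_geometric_of_lt_one (by positivity) h4).mul_right M)
      simp only [hterm, norm_mul, norm_div, norm_pow, norm_neg, Complex.norm_natCast,
        Complex.norm_real, Real.norm_of_nonneg (hW0 _)]
      rw [integral_const_mul]
      have h5 := integral_pow_le_of_exp_sqrt hW hW0 hexp m
      have hm : (m.factorial : ℝ) ≠ 0 := by positivity
      calc ‖τ‖ ^ m / (m.factorial : ℝ) ^ 2 * ∫ ω, W ω ^ m ∂P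
          ≤ ‖τ‖ ^ m / (m.factorial : ℝ) ^ 2 * (4 ^ m * (m.factorial : ℝ) ^ 2 * M) := by gcongr
        _ = _ := by
          rw [mul_pow]
          field_simp
  · have hexp1 : IntegrableOn (fun τ : ℝ => Real.exp (-τ)) (Set.Ioi 0) := by
      simpa using (integral_pow_mul_exp_neg 0).1
    -- On the half line `bessel` is bounded by one, so `e^{-τ}` alone dominates.
    have hprod : Integrable (fun p : ℝ × Ω => Complex.exp (-(p.1 : ℂ)) * bessel (p.1 * W p.2))
        ((volume.restrict (Set.Ioi (0 : ℝ))).prod P) := by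
      have h1 : Integrable (fun p : ℝ × Ω => Real.exp (-p.1) * (1 : ℝ))
          ((volume.restrict (Set.Ioi (0 : ℝ))).prod P) :=
        Integrable.mul_prod (f := fun τ : ℝ => Real.exp (-τ)) (g := fun _ : Ω => (1 : ℝ)) hexp1
          (integrable_const _)
      refine h1.mono' ?_ ?_
      · have : Measurable fun p : ℝ × Ω => bessel (p.1 * W p.2) :=
          hcb.measurable.comp (by fun_prop)
        exact Measurable.aestronglyMeasurable (by fun_prop)
      · have hmem : ∀ᵐ p ∂((volume.restrict (Set.Ioi (0 : ℝ))).prod P), p.1 ∈ Set.Ioi (0 : ℝ) :=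
          (Measure.quasiMeasurePreserving_fst).ae (ae_restrict_mem measurableSet_Ioi)
        filter_upwards [hmem] with p hp
        rw [norm_mul, ← Complex.ofReal_neg, ← Complex.ofReal_exp, Complex.norm_real,
          Real.norm_eq_abs, Real.abs_exp, ← Complex.ofReal_mul]
        gcongr
        exact norm_bessel_ofReal_le (mul_nonneg (le_of_lt hp) (hW0 _))
    have hswap := integral_integral_swap
      (f := fun (τ : ℝ) (ω : Ω) => Complex.exp (-(τ : ℂ)) * bessel (τ * W ω)) hprod
    simp only [integral_exp_neg_mul_bessel (hW0 _)] at hswap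
    refine ⟨?_, ?_⟩
    · have := hprod.integral_prod_left
      simpa only [integral_const_mul, IntegrableOn] using this
    · rw [← hswap]
      simp only [integral_const_mul]

end

end LevyBorel

namespace LevyBorel

variable {d : ℕ}

noncomputable section

/-! ### Derivatives of Laplace transforms -/

/-- Continuous functions of at most exponential growth. -/
structure ExpBounded {W : Type*} [NormedAddCommGroup W] (Q : E d → W) : Prop where
  continuous : Continuous Q
  bound : ∃ C c : ℝ, 0 ≤ C ∧ 0 ≤ c ∧ ∀ x, ‖Q x‖ ≤ C * Real.exp (c * ‖x‖)

theorem ExpBounded.integrable {W : Type*} [NormedAddCommGroup W] {Q : E d → W}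
    (hQ : ExpBounded Q) {μ : Measure (E d)} (hμ : HasExpMoments μ) : Integrable Q μ := by
  obtain ⟨C, c, -, hc, h⟩ := hQ.bound
  exact ((hμ c hc).const_mul C).mono' hQ.continuous.aestronglyMeasurable (ae_of_all _ h)

theorem ExpBounded.smul {W : Type*} [NormedAddCommGroup W] [NormedSpace ℝ W] {f : E d → ℝ}
    {Q : E d → W} (hf : ExpBounded f) (hQ : ExpBounded Q) : ExpBounded fun x => f x • Q x := by
  obtain ⟨C, c, hC, hc, h⟩ := hf.bound
  obtain ⟨C', c', hC', hc', h'⟩ := hQ.bound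
  refine ⟨hf.continuous.smul hQ.continuous, C * C', c + c', by positivity, by positivity,
    fun x => ?_⟩
  rw [norm_smul, add_mul, Real.exp_add]
  calc ‖f x‖ * ‖Q x‖ ≤ (C * Real.exp (c * ‖x‖)) * (C' * Real.exp (c' * ‖x‖)) := by
        gcongr
        · exact h x
        · exact h' x
    _ = _ := by ring

theorem expBounded_const {W : Type*} [NormedAddCommGroup W] (w : W) :
    ExpBounded fun _ : E d => w :=
  ⟨continuous_const, ‖w‖, 0, norm_nonneg _, le_rfl, fun x => by simp⟩

theorem expBounded_inner (v : E d) : ExpBounded fun x : E d => (inner ℝ x v : ℝ) := by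
  refine ⟨by fun_prop, ‖v‖, 1, norm_nonneg _, zero_le_one, fun x => ?_⟩
  refine (norm_inner_le_norm x v).trans ?_
  rw [mul_comm, one_mul]
  gcongr
  linarith [Real.add_one_le_exp ‖x‖]

theorem expBounded_exp_inner (v : E d) : ExpBounded fun x : E d => Real.exp (inner ℝ x v) := by
  refine ⟨by fun_prop, 1, ‖v‖, zero_le_one, norm_nonneg _, fun x => ?_⟩
  rw [one_mul, Real.norm_eq_abs, Real.abs_exp, mul_comm]
  exact Real.exp_le_exp.2 (real_inner_le_norm x v)

theorem expBounded_prod_inner {ι : Type*} (s : Finset ι) (v : ι → E d) :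
    ExpBounded fun x : E d => ∏ i ∈ s, (inner ℝ x (v i) : ℝ) := by
  classical
  induction s using Finset.induction_on with
  | empty => simpa using expBounded_const (1 : ℝ)
  | insert a s ha ih =>
    simp only [Finset.prod_insert ha]
    exact (expBounded_inner (v a)).smul ih

theorem ExpBounded.smulRight {W : Type*} [NormedAddCommGroup W] [NormedSpace ℝ W] {Q : E d → W}
    (hQ : ExpBounded Q) : ExpBounded fun x => (innerSL ℝ x).smulRight (Q x) := by
  obtain ⟨C, c, hC, hc, h⟩ := hQ.bound
  refine ⟨?_, C, c + 1, hC, by positivity, fun x => ?_⟩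
  · have h1 : Continuous fun x : E d => innerSL ℝ x := (innerSL ℝ).continuous
    have h2 := hQ.continuous
    fun_prop
  · rw [ContinuousLinearMap.norm_smulRight_apply, innerSL_apply_norm, add_mul, one_mul,
      Real.exp_add]
    have h1 : ‖x‖ ≤ Real.exp ‖x‖ := by linarith [Real.add_one_le_exp ‖x‖]
    calc ‖x‖ * ‖Q x‖ ≤ Real.exp ‖x‖ * (C * Real.exp (c * ‖x‖)) := by
          gcongr
          exact h x
      _ = _ := by ring

section

variable {W : Type} [NormedAddCommGroup W] [NormedSpace ℝ W] {Q : E d → W} {μ : Measure (E d)}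

/-- The derivative has the same form, with a new integrand that is again of exponential growth.
Allowing vector values of `Q` thus makes the class stable under differentiation, and higher
derivatives follow by induction. -/
theorem hasFDerivAt_integral_exp_inner (hQ : ExpBounded Q) (hμ : HasExpMoments μ) (η₀ : E d) :
    HasFDerivAt (fun η => ∫ x, Real.exp (inner ℝ x η) • Q x ∂μ)
      (∫ x, Real.exp (inner ℝ x η₀) • (innerSL ℝ x).smulRight (Q x) ∂μ) η₀ := by
  have hQ' := hQ.smulRight
  obtain ⟨C, c, hC, hc, h⟩ := hQ'.bound
  refine hasFDerivAt_integral_of_dominated_of_fderiv_le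
    (F := fun η x => Real.exp (inner ℝ x η) • Q x)
    (F' := fun η x => Real.exp (inner ℝ x η) • (innerSL ℝ x).smulRight (Q x))
    -- The number `‖η₀‖ + 1` bounds `‖η‖` on the unit ball around `η₀`.
    (bound := fun x => C * Real.exp ((‖η₀‖ + 1 + c) * ‖x‖))
    (Metric.ball_mem_nhds η₀ one_pos) (Eventually.of_forall fun η => ?_) ?_ ?_ ?_ ?_ ?_
  · exact ((expBounded_exp_inner η).smul hQ).continuous.aestronglyMeasurable
  · exact ((expBounded_exp_inner η₀).smul hQ).integrable hμ
  · exact ((expBounded_exp_inner η₀).smul hQ').continuous.aestronglyMeasurable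
  · refine ae_of_all _ fun x η hη => ?_
    rw [norm_smul, Real.norm_eq_abs, Real.abs_exp, add_mul, Real.exp_add]
    have h1 : ‖η‖ ≤ ‖η₀‖ + 1 := by
      have := norm_le_norm_add_norm_sub' η η₀
      rw [Metric.mem_ball, dist_eq_norm] at hη
      linarith
    have h2 : inner ℝ x η ≤ (‖η₀‖ + 1) * ‖x‖ := by
      refine (real_inner_le_norm x η).trans ?_
      rw [mul_comm]
      gcongr
    calc Real.exp (inner ℝ x η) * ‖(innerSL ℝ x).smulRight (Q x)‖
        ≤ Real.exp ((‖η₀‖ + 1) * ‖x‖) * (C * Real.exp (c * ‖x‖)) := by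
          gcongr
          exact h x
      _ = _ := by ring
  · exact (hμ _ (by positivity)).const_mul C
  · refine ae_of_all _ fun x η _ => ?_
    have h1 : HasFDerivAt (fun η : E d => (inner ℝ x η : ℝ)) (innerSL ℝ x) η :=
      (innerSL ℝ x).hasFDerivAt
    refine (h1.exp.smul_const (Q x)).congr_fderiv ?_
    ext v
    simp [mul_smul]

theorem iteratedFDeriv_integral_exp_inner [CompleteSpace W] (hQ : ExpBounded Q) (hμ : HasExpMoments μ) (n : ℕ)
    (η : E d) (v : Fin n → E d) :
    iteratedFDeriv ℝ n (fun η => ∫ x, Real.exp (inner ℝ x η) • Q x ∂μ) η v =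
      ∫ x, (Real.exp (inner ℝ x η) * ∏ i, (inner ℝ x (v i) : ℝ)) • Q x ∂μ := by
  induction n generalizing W with
  | zero => simp
  | succ n ih =>
    have hfd : (fun η => fderiv ℝ (fun η => ∫ x, Real.exp (inner ℝ x η) • Q x ∂μ) η) =
        fun η => ∫ x, Real.exp (inner ℝ x η) • (innerSL ℝ x).smulRight (Q x) ∂μ :=
      funext fun η => (hasFDerivAt_integral_exp_inner hQ hμ η).fderiv
    rw [iteratedFDeriv_succ_apply_right, hfd, ih hQ.smulRight,
      ContinuousLinearMap.integral_apply]
    · refine integral_congr_ae (ae_of_all _ fun x => ?_)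
      simp only [_root_.smul_apply, ContinuousLinearMap.smulRight_apply,
        innerSL_apply_apply, Fin.prod_univ_castSucc, smul_smul, Fin.init]
      rw [mul_assoc]
    · exact (((expBounded_exp_inner η).smul (expBounded_prod_inner _ _)).smul
        hQ.smulRight).integrable hμ

theorem contDiff_integral_exp_inner (hQ : ExpBounded Q) (hμ : HasExpMoments μ) (n : ℕ) :
    ContDiff ℝ n (fun η => ∫ x, Real.exp (inner ℝ x η) • Q x ∂μ) := by
  induction n generalizing W with
  | zero =>
    exact contDiff_zero.2 (continuous_iff_continuousAt.2 fun η =>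
      (hasFDerivAt_integral_exp_inner hQ hμ η).continuousAt)
  | succ n ih =>
    push_cast
    exact contDiff_succ_iff_hasFDerivAt.2 ⟨_, ih hQ.smulRight,
      hasFDerivAt_integral_exp_inner hQ hμ⟩

end

/-! ### Faà di Bruno's formula for the exponential -/

/-- Every derivative of the exponential is the exponential, so the outer factor in Faà di Bruno's
formula is the same for all partitions. -/
theorem iteratedFDeriv_exp_comp {V : Type*} [NormedAddCommGroup V] [NormedSpace ℝ V] {H : V → ℝ}
    {x : V} (n : ℕ) (hH : ContDiffAt ℝ n H x) (v : Fin n → V) :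
    iteratedFDeriv ℝ n (fun y => Real.exp (H y)) x v =
      ∑ c : OrderedFinpartition n, Real.exp (H x) *
        ∏ j, iteratedFDeriv ℝ (c.partSize j) H x (v ∘ c.emb j) := by
  have h := iteratedFDeriv_comp (g := Real.exp) (n := (n : WithTop ℕ∞))
    (Real.contDiff_exp.contDiffAt) hH (i := n) le_rfl
  have h2 : (fun y => Real.exp (H y)) = Real.exp ∘ H := rfl
  rw [h2, h, FormalMultilinearSeries.taylorComp, _root_.sum_apply]
  refine Finset.sum_congr rfl fun c _ => ?_
  rw [FormalMultilinearSeries.compAlongOrderedFinpartition_apply]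
  simp only [ftaylorSeries]
  have hexp : iteratedDeriv c.length Real.exp (H x) = Real.exp (H x) := by
    rw [iteratedDeriv_eq_iterate, Real.iter_deriv_exp]
  rw [iteratedFDeriv_apply_eq_iteratedDeriv_mul_prod, hexp, smul_eq_mul, mul_comm]
  rfl

/-! ### The real symbol and its derivatives -/

/-- The polynomial part of the symbol on `ℝ^d`. -/
def LevyTriple.polyPart (L : LevyTriple d) (η : E d) : ℝ :=
  -(∑ k, L.a k * η k) + (∑ k, ∑ l, η k * L.D k l * η l) - L.z

/-- The symbol on `ℝ^d`. -/
def LevyTriple.realSymbol (L : LevyTriple d) (η : E d) : ℝ :=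
  L.polyPart η + L.z * ∫ x, Real.exp (inner ℝ x η) • (1 : ℝ) ∂(L.r.map fun x => -x)

theorem HasExpMoments.map_sub {μ : Measure (E d)} (hμ : HasExpMoments μ) (φ : E d) :
    HasExpMoments (μ.map fun x => φ - x) := by
  intro c hc
  rw [integrable_map_measure (by fun_prop) (by fun_prop)]
  refine ((hμ c hc).const_mul (Real.exp (c * ‖φ‖))).mono' (by fun_prop) (ae_of_all _ fun x => ?_)
  rw [Function.comp_apply, Real.norm_eq_abs, Real.abs_exp, ← Real.exp_add, ← mul_add]
  gcongr
  exact norm_sub_le φ x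

theorem HasExpMoments.map_neg {μ : Measure (E d)} (hμ : HasExpMoments μ) :
    HasExpMoments (μ.map fun x => -x) := by
  simpa using hμ.map_sub 0

theorem sum_mul_ofReal (x η : E d) :
    ∑ k, (x k : ℂ) * (η k : ℂ) = ((inner ℝ x η : ℝ) : ℂ) := by
  rw [PiLp.inner_apply]
  push_cast
  refine Finset.sum_congr rfl fun k _ => ?_
  simp only [RCLike.inner_apply, conj_trivial]
  push_cast
  ring

/-- Reflecting the jumps turns `e^{-⟨x, η⟩}` into `e^{⟨x, η⟩}`, the form to which the derivative
formulas apply; the `-1` goes into the polynomial part as `-z`. -/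
theorem LevyTriple.symbol_ofReal (L : LevyTriple d) (hr : IsCompact L.r.support) (η : E d) :
    L.symbol (fun k => (η k : ℂ)) = (L.realSymbol η : ℂ) := by
  have := L.r_prob
  have hrm : HasExpMoments L.r := HasExpMoments.of_isCompact_support hr
  have h1 := hrm.integrable_pairing (fun k => (η k : ℂ))
  rw [LevyTriple.symbol, LevyTriple.realSymbol, LevyTriple.polyPart,
    integral_map (by fun_prop) (Continuous.aestronglyMeasurable (by fun_prop)),
    integral_sub h1 (integrable_const _)]
  have h2 : ∫ x, Complex.exp (-(∑ k, (x k : ℂ) * (η k : ℂ))) ∂L.r =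
      ((∫ x, Real.exp (inner ℝ (-x) η) • (1 : ℝ) ∂L.r : ℝ) : ℂ) := by
    rw [← integral_complex_ofReal]
    refine integral_congr_ae (ae_of_all _ fun x => ?_)
    simp [sum_mul_ofReal]
  rw [h2]
  simp only [integral_const, probReal_univ, one_smul]
  push_cast
  ring

theorem LevyTriple.contDiff_polyPart (L : LevyTriple d) {n : WithTop ℕ∞} :
    ContDiff ℝ n L.polyPart := by
  unfold LevyTriple.polyPart
  have h : ∀ k, ContDiff ℝ n fun η : E d => η k := fun k => contDiff_piLp_apply (p := 2)
  fun_prop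

theorem LevyTriple.contDiff_realSymbol (L : LevyTriple d) (hr : IsCompact L.r.support) (n : ℕ) :
    ContDiff ℝ n L.realSymbol := by
  have := L.r_prob
  have hrm : HasExpMoments L.r := HasExpMoments.of_isCompact_support hr
  exact L.contDiff_polyPart.add
    (contDiff_const.mul (contDiff_integral_exp_inner (expBounded_const 1) hrm.map_neg n))

/-- The derivatives of the symbol are symmetric. -/
theorem LevyTriple.iteratedFDeriv_realSymbol_perm (L : LevyTriple d)
    (hr : IsCompact L.r.support) {n : ℕ} (v : Fin n → E d) (σ : Equiv.Perm (Fin n)) :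
    iteratedFDeriv ℝ n L.realSymbol 0 (v ∘ σ) = iteratedFDeriv ℝ n L.realSymbol 0 v := by
  have := L.r_prob
  have hrm : HasExpMoments L.r := HasExpMoments.of_isCompact_support hr
  have hF := contDiff_integral_exp_inner (expBounded_const (d := d) (1 : ℝ)) hrm.map_neg n
  -- The polynomial part is symmetric by smoothness; the derivative of the jump part is an explicit
  -- product, visibly symmetric.
  have h : ∀ w : Fin n → E d, iteratedFDeriv ℝ n L.realSymbol 0 w =
      iteratedFDeriv ℝ n L.polyPart 0 w + L.z * ∫ x,
        (Real.exp (inner ℝ x (0 : E d)) * ∏ i, (inner ℝ x (w i) : ℝ)) • (1 : ℝ)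
          ∂(L.r.map fun x => -x) := fun w => by
    rw [← iteratedFDeriv_integral_exp_inner (expBounded_const 1) hrm.map_neg]
    have h1 := iteratedFDeriv_add_apply (x := (0 : E d)) (i := n)
      (L.contDiff_polyPart.contDiffAt) (contDiff_const.smul hF : ContDiff ℝ n (L.z • fun η => _)).contDiffAt
    have h2 := iteratedFDeriv_const_smul_apply (x := (0 : E d)) (i := n) (a := L.z)
      hF.contDiffAt
    rw [h2] at h1
    exact congrArg (fun q => q w) h1
  rw [h, h]
  congr 1
  · exact (L.contDiff_polyPart.contDiffAt).iteratedFDeriv_comp_perm v σ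
  · congr 2
    funext x
    congr 2
    exact Fintype.prod_equiv σ _ _ fun i => rfl

theorem LevyTriple.coeff_eq (L : LevyTriple d) (hr : IsCompact L.r.support) (n : ℕ)
    (X : Fin n → Fin d) : L.coeff n X = ((iteratedFDeriv ℝ n L.realSymbol 0
      fun i => EuclideanSpace.single (X i) (1 : ℝ) : ℝ) : ℂ) := by
  rw [LevyTriple.coeff, funext (L.symbol_ofReal hr)]
  have h := Complex.ofRealCLM.iteratedFDeriv_comp_left
    (L.contDiff_realSymbol hr n).contDiffAt (x := (0 : E d)) (i := n) le_rfl
  exact congrArg (fun q => q fun i => EuclideanSpace.single (X i) (1 : ℝ)) h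

theorem LevyTriple.coeff_perm (L : LevyTriple d) (hr : IsCompact L.r.support) {n : ℕ}
    (X : Fin n → Fin d) (σ : Equiv.Perm (Fin n)) : L.coeff n (X ∘ σ) = L.coeff n X := by
  rw [L.coeff_eq hr, L.coeff_eq hr]
  exact congrArg _ (L.iteratedFDeriv_realSymbol_perm hr
    (fun i => EuclideanSpace.single (X i) (1 : ℝ)) σ)

/-- A linear form has no derivatives beyond the first; this is why an outer vertex meets exactly one
edge. -/
theorem iteratedFDeriv_inner_zero (φ : E d) {n : ℕ} (hn : 0 < n) (v : Fin n → E d) :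
    iteratedFDeriv ℝ n (fun η : E d => (inner ℝ φ η : ℝ)) 0 v =
      if n = 1 then ∏ i, (inner ℝ φ (v i) : ℝ) else 0 := by
  obtain ⟨n, rfl⟩ := Nat.exists_eq_succ_of_ne_zero hn.ne'
  have hfd : (fun η => fderiv ℝ (fun η : E d => (inner ℝ φ η : ℝ)) η) = fun _ => innerSL ℝ φ :=
    funext fun η => (innerSL ℝ φ).hasFDerivAt.fderiv
  refine (iteratedFDeriv_succ_apply_right v).trans ?_
  rw [hfd]
  rcases Nat.eq_zero_or_pos n with rfl | hn
  · simp
  · rw [iteratedFDeriv_const_of_ne hn.ne', if_neg (by omega)]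
    simp

/-- The joint moments of `φ - X`, where `X` has the law `ν_t`, in terms of cumulants. -/
theorem LevyTriple.moment_eq (L : LevyTriple d) (hr : IsCompact L.r.support) {t : ℝ}
    {μ : Measure (E d)} (hμ : HasExpMoments μ)
    (hL : ∀ η, laplace μ η = Complex.exp (t * L.symbol η)) (φ : E d) (n : ℕ) (X : Fin n → Fin d) :
    ((∫ y, ∏ i, y (X i) ∂(μ.map fun x => φ - x) : ℝ) : ℂ) =
      ∑ c : OrderedFinpartition n, ∏ j : Fin c.length,
        ((if c.partSize j = 1 then ∏ i, (φ (X (c.emb j i)) : ℂ) else 0) +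
          t * L.coeff (c.partSize j) (X ∘ c.emb j)) := by
  set v : Fin n → E d := fun i => EuclideanSpace.single (X i) (1 : ℝ) with hv
  have hinner : ∀ (y : E d) (i : Fin n), (inner ℝ y (v i) : ℝ) = y (X i) := fun y i => by
    simp [hv, EuclideanSpace.inner_single_right]
  have hμφ := hμ.map_sub φ
  -- The law of `φ - X` has cumulant generating function `⟨φ, η⟩ + tΨ(η)`.
  have hexp : (fun η => ∫ y, Real.exp (inner ℝ y η) • (1 : ℝ) ∂(μ.map fun x => φ - x)) =
      fun η => Real.exp (inner ℝ φ η + t * L.realSymbol η) := by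
    funext η
    have h1 := hL (fun k => (η k : ℂ))
    rw [L.symbol_ofReal hr, laplace] at h1
    simp only [sum_mul_ofReal] at h1
    have h2 : ∫ x, Real.exp (-(inner ℝ x η)) ∂μ = Real.exp (t * L.realSymbol η) := by
      have h3 : ((∫ x, Real.exp (-(inner ℝ x η)) ∂μ : ℝ) : ℂ) =
          ((Real.exp (t * L.realSymbol η) : ℝ) : ℂ) := by
        rw [← integral_complex_ofReal]
        push_cast
        exact h1
      exact_mod_cast h3
    rw [integral_map (by fun_prop) (Continuous.aestronglyMeasurable (by fun_prop)), Real.exp_add,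
      ← h2, ← integral_const_mul]
    refine integral_congr_ae (ae_of_all _ fun x => ?_)
    simp only [smul_eq_mul, mul_one, inner_sub_left]
    rw [← Real.exp_add, sub_eq_add_neg]
  have hS := L.contDiff_realSymbol hr
  have hlin : ∀ k : ℕ, ContDiff ℝ k fun η : E d => (inner ℝ φ η : ℝ) := fun k =>
    (innerSL ℝ φ).contDiff
  have h1 := iteratedFDeriv_integral_exp_inner (expBounded_const (1 : ℝ)) hμφ n 0 v
  rw [hexp, iteratedFDeriv_exp_comp n ((hlin n).add (contDiff_const.mul (hS n))).contDiffAt] at h1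
  simp only [inner_zero_right, Real.exp_zero, one_mul, hinner, smul_eq_mul, mul_one] at h1
  -- With `Ψ(0) = 0` the exponential prefactor in Faà di Bruno's formula is one.
  have h0 : L.realSymbol 0 = 0 := by
    have := L.r_prob
    have h2 := L.symbol_ofReal hr 0
    simp only [LevyTriple.symbol, PiLp.zero_apply, Complex.ofReal_zero, mul_zero,
      Finset.sum_const_zero, neg_zero, Complex.exp_zero, sub_self, integral_zero, add_zero] at h2
    exact_mod_cast h2.symm
  rw [← h1]
  push_cast
  refine Finset.sum_congr rfl fun c _ => ?_
  rw [h0]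
  simp only [mul_zero, Complex.ofReal_zero, add_zero, Complex.exp_zero, one_mul]
  refine Finset.prod_congr rfl fun j _ => ?_
  rw [L.coeff_eq hr]
  have h2 : iteratedFDeriv ℝ (c.partSize j)
      (fun y => (inner ℝ φ y : ℝ) + t * L.realSymbol y) 0 (v ∘ c.emb j) =
      iteratedFDeriv ℝ (c.partSize j) (fun y => (inner ℝ φ y : ℝ)) 0 (v ∘ c.emb j) +
        t * iteratedFDeriv ℝ (c.partSize j) L.realSymbol 0 (v ∘ c.emb j) := by
    have hts : ContDiff ℝ (c.partSize j) (t • L.realSymbol) := contDiff_const.smul (hS _)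
    have h3 := iteratedFDeriv_add_apply (x := (0 : E d)) (g := t • L.realSymbol)
      (hlin (c.partSize j)).contDiffAt hts.contDiffAt
    rw [iteratedFDeriv_const_smul_apply (hS _).contDiffAt] at h3
    exact congrArg (fun q => q (v ∘ c.emb j)) h3
  rw [h2, iteratedFDeriv_inner_zero φ (c.partSize_pos j)]
  push_cast
  congr 1
  split_ifs
  · push_cast
    exact Finset.prod_congr rfl fun i _ => by rw [Function.comp_apply, hinner]
  · simp

end

end LevyBorel

namespace LevyBorel

variable {d : ℕ}

noncomputable section

/-! ### Ordered partitions are determined by their equivalence relation -/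

section OrderedPartitions

open OrderedFinpartition

theorem index_eq_of_emb_eq {n : ℕ} (c : OrderedFinpartition n) {j : Fin c.length}
    {r : Fin (c.partSize j)} {i : Fin n} (h : c.emb j r = i) : c.index i = j := by
  by_contra hne
  exact c.emb_ne_emb_of_ne hne ((c.emb_invEmbedding i).trans h.symm)

theorem index_emb {n : ℕ} (c : OrderedFinpartition n) (j : Fin c.length)
    (r : Fin (c.partSize j)) : c.index (c.emb j r) = j :=
  index_eq_of_emb_eq c rfl

theorem index_surjective {n : ℕ} (c : OrderedFinpartition n) : Function.Surjective c.index :=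
  fun j => ⟨c.emb j ⟨0, c.partSize_pos j⟩, index_emb c j _⟩

theorem index_eq_iff {n : ℕ} (c : OrderedFinpartition n) {i : Fin n} {j : Fin c.length} :
    c.index i = j ↔ ∃ r, c.emb j r = i := by
  refine ⟨?_, fun ⟨r, hr⟩ => index_eq_of_emb_eq c hr⟩
  rintro rfl
  exact ⟨_, c.emb_invEmbedding i⟩

theorem index_extendLeft_zero {n : ℕ} (c : OrderedFinpartition n) :
    c.extendLeft.index 0 = (0 : Fin (c.length + 1)) :=
  index_eq_of_emb_eq c.extendLeft (j := (0 : Fin (c.length + 1))) (r := ⟨0, by simp⟩) rfl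

theorem index_extendLeft_succ {n : ℕ} (c : OrderedFinpartition n) (i : Fin n) :
    c.extendLeft.index i.succ = (c.index i).succ :=
  index_eq_of_emb_eq c.extendLeft (j := (c.index i).succ) (r := Fin.cast (by simp) (c.invEmbedding i))
    (congrArg Fin.succ (c.emb_invEmbedding i) :)

theorem index_extendMiddle_succ {n : ℕ} (c : OrderedFinpartition n) (k : Fin c.length)
    (i : Fin n) : (c.extendMiddle k).index i.succ = c.index i := by
  rcases eq_or_ne (c.index i) k with rfl | hi
  · have A : Function.update c.partSize (c.index i) (c.partSize (c.index i) + 1) (c.index i) =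
      c.partSize (c.index i) + 1 := by simp
    exact index_eq_of_emb_eq (c.extendMiddle (c.index i)) (j := c.index i)
      (r := (Fin.succ (c.invEmbedding i)).cast A.symm) (by simp [extendMiddle])
  · have A : Function.update c.partSize k (c.partSize k + 1) (c.index i) =
      c.partSize (c.index i) := by simp [hi]
    exact index_eq_of_emb_eq (c.extendMiddle k) (j := c.index i)
      (r := (c.invEmbedding i).cast A.symm) (by simp [extendMiddle, hi])

theorem index_extend_succ_eq_iff {n : ℕ} (c : OrderedFinpartition n) (o : Option (Fin c.length))
    (i j : Fin n) : (c.extend o).index i.succ = (c.extend o).index j.succ ↔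
      c.index i = c.index j := by
  cases o with
  | none =>
    rw [extend_none, index_extendLeft_succ, index_extendLeft_succ]
    exact Fin.succ_inj
  | some k =>
    rw [extend_some, index_extendMiddle_succ, index_extendMiddle_succ]
    exact Iff.rfl

theorem index_extend_zero_eq_iff {n : ℕ} (c : OrderedFinpartition n) (o : Option (Fin c.length))
    (i : Fin n) : (c.extend o).index 0 = (c.extend o).index i.succ ↔ o = some (c.index i) := by
  cases o with
  | none =>
    rw [extend_none, index_extendLeft_succ, index_extendLeft_zero]
    simp only [reduceCtorEq, iff_false]
    exact (Fin.succ_ne_zero _).symm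
  | some k =>
    rw [extend_some, index_extendMiddle_succ, index_extendMiddle_zero, Option.some_inj]
    exact Iff.rfl

theorem exists_extend_eq {n : ℕ} (c : OrderedFinpartition (n + 1)) :
    ∃ (c₁ : OrderedFinpartition n) (o : Option (Fin c₁.length)), c₁.extend o = c :=
  let p := (extendEquiv n).symm c
  ⟨p.1, p.2, (extendEquiv n).apply_symm_apply c⟩

/-- Induction on `n`: the relation among successors determines the smaller partition, and the class
of `0` determines the extension step. Hence each set partition is counted only once in a sum over
`OrderedFinpartition`. -/
theorem eq_of_index_eq_iff {n : ℕ} (c c' : OrderedFinpartition n)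
    (h : ∀ i j, c.index i = c.index j ↔ c'.index i = c'.index j) : c = c' := by
  induction n with
  | zero => exact Subsingleton.elim _ _
  | succ n ih =>
    obtain ⟨c₁, o, rfl⟩ := exists_extend_eq c
    obtain ⟨c₁', o', rfl⟩ := exists_extend_eq c'
    obtain rfl : c₁ = c₁' := ih c₁ c₁' fun i j => by
      have := h i.succ j.succ
      rwa [index_extend_succ_eq_iff, index_extend_succ_eq_iff] at this
    have h0 : ∀ i, o = some (c₁.index i) ↔ o' = some (c₁.index i) := fun i => by
      have := h 0 i.succ
      rwa [index_extend_zero_eq_iff, index_extend_zero_eq_iff] at this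
    have h1 : ∀ k, o = some k ↔ o' = some k := fun k => by
      obtain ⟨i, rfl⟩ := index_surjective c₁ k
      exact h0 i
    have ho : o = o' := Option.ext h1
    rw [ho]

/-- Restrict `f` to successors, then either add `0` to the part with the same value or, if there is
none, make it a new singleton. -/
theorem exists_index_eq_iff {n : ℕ} {α : Type*} (f : Fin n → α) :
    ∃ c : OrderedFinpartition n, ∀ i j, c.index i = c.index j ↔ f i = f j := by
  classical
  induction n with
  | zero => exact ⟨default, fun i => i.elim0⟩
  | succ n ih =>
    obtain ⟨c, hc⟩ := ih (f ∘ Fin.succ)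
    obtain ⟨o, ho⟩ : ∃ o : Option (Fin c.length), ∀ i, o = some (c.index i) ↔ f 0 = f i.succ := by
      by_cases h : ∃ i : Fin n, f 0 = f i.succ
      · obtain ⟨i, hi⟩ := h
        refine ⟨some (c.index i), fun j => ?_⟩
        rw [Option.some_inj, hc, hi]
        rfl
      · refine ⟨none, fun i => ?_⟩
        simp only [reduceCtorEq, false_iff]
        exact fun hi => h ⟨i, hi⟩
    refine ⟨c.extend o, fun i j => ?_⟩
    induction i using Fin.cases with
    | zero =>
      induction j using Fin.cases with
      | zero => simp
      | succ j => rw [index_extend_zero_eq_iff, ho]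
    | succ i =>
      induction j using Fin.cases with
      | zero => rw [eq_comm, index_extend_zero_eq_iff, ho, eq_comm]
      | succ j => rw [index_extend_succ_eq_iff, hc]; rfl

end OrderedPartitions

/-! ### Feynman graphs and ordered partitions -/

/-- A bijection of sum types which preserves the sides is a sum of bijections. -/
theorem exists_sum_map_of_isRight {A B A' B' : Type*} (σ : A ⊕ B ≃ A' ⊕ B')
    (h : ∀ x, (σ x).isRight = x.isRight) :
    ∃ (e : A ≃ A') (o : B ≃ B'), ∀ x, σ x = Sum.map e o x := by
  have hl : ∀ a, ∃ a', σ (Sum.inl a) = Sum.inl a' := fun a => by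
    have := h (Sum.inl a)
    rcases hx : σ (Sum.inl a) with a' | b'
    · exact ⟨a', rfl⟩
    · rw [hx] at this; simp at this
  have hr : ∀ b, ∃ b', σ (Sum.inr b) = Sum.inr b' := fun b => by
    have := h (Sum.inr b)
    rcases hx : σ (Sum.inr b) with a' | b'
    · rw [hx] at this; simp at this
    · exact ⟨b', rfl⟩
  choose f hf using hl
  choose g hg using hr
  have hfb : Function.Bijective f := by
    refine ⟨fun a a' haa => ?_, fun a' => ?_⟩
    · have := (hf a).trans ((congrArg Sum.inl haa).trans (hf a').symm)
      simpa using this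
    · rcases hx : σ.symm (Sum.inl a') with a | b
      · refine ⟨a, ?_⟩
        have := (σ.symm_apply_eq.1 hx).trans (hf a)
        simpa using this.symm
      · have := (σ.symm_apply_eq.1 hx).trans (hg b)
        simp at this
  have hgb : Function.Bijective g := by
    refine ⟨fun a a' haa => ?_, fun a' => ?_⟩
    · have := (hg a).trans ((congrArg Sum.inr haa).trans (hg a').symm)
      simpa using this
    · rcases hx : σ.symm (Sum.inr a') with a | b
      · have := (σ.symm_apply_eq.1 hx).trans (hf a)
        simp at this
      · refine ⟨b, ?_⟩
        have := (σ.symm_apply_eq.1 hx).trans (hg b)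
        simpa using this.symm
  refine ⟨Equiv.ofBijective f hfb, Equiv.ofBijective g hgb, fun x => ?_⟩
  rcases x with a | b
  · exact hf a
  · exact hg b

variable {m n : ℕ} (e : Leg m ≃ Fin n)

/-- Ordered partitions with a set of marked singletons. -/
abbrev MarkedPartition (n : ℕ) : Type :=
  Σ c : OrderedFinpartition n, {O : Finset (Fin c.length) // ∀ j ∈ O, c.partSize j = 1}

/-- The graph `G` realizes the marked partition `p`: its empty vertices are the parts of `p`, the
outer ones being the marked parts. -/
def MarkedPartition.Realizes (p : MarkedPartition n) (G : LabelledGraph m) : Prop :=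
  ∃ b : Fin p.1.length ≃ Fin G.numInner ⊕ Fin G.numOuter,
    (∀ l, G.edge l = b (p.1.index (e l))) ∧ ∀ j, j ∈ p.2.1 ↔ (b j).isRight = true

theorem MarkedPartition.exists_graph (p : MarkedPartition n) :
    ∃ G : LabelledGraph m, p.Realizes e G := by
  obtain ⟨c, O, hO⟩ := p
  -- The predicate is non-membership, so that unmarked parts land on the left, among the inner
  -- vertices.
  let b : Fin c.length ≃ Fin (Fintype.card {j // j ∉ O}) ⊕ Fin (Fintype.card {j // ¬ j ∉ O}) :=
    (Equiv.sumCompl fun j => j ∉ O).symm.trans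
      (Equiv.sumCongr (Fintype.equivFin _) (Fintype.equivFin _))
  have hb : ∀ j, j ∈ O ↔ (b j).isRight = true := fun j => by
    by_cases h : j ∈ O
    · have h' : ¬ j ∉ O := not_not.2 h
      simp [b, Equiv.sumCompl_symm_apply_of_neg (p := fun j => j ∉ O) h', h]
    · simp [b, Equiv.sumCompl_symm_apply_of_pos (p := fun j => j ∉ O) h, h]
  refine ⟨⟨_, _, fun l => b (c.index (e l)),
    b.surjective.comp ((index_surjective c).comp e.surjective), fun l l' v hl hl' => ?_⟩,
    b, fun l => rfl, hb⟩
  have hj : c.index (e l) ∈ O := (hb _).2 (by rw [hl]; rfl)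
  have hidx : c.index (e l') = c.index (e l) := b.injective (hl'.trans hl.symm)
  obtain ⟨r, hr⟩ := (index_eq_iff c).1 (rfl : c.index (e l) = _)
  obtain ⟨r', hr'⟩ := (index_eq_iff c).1 hidx
  have hrr : r = r' := by
    have h1 := hO _ hj
    ext
    omega
  exact e.injective (by rw [← hr, ← hr', hrr])

theorem LabelledGraph.exists_markedPartition (G : LabelledGraph m) :
    ∃ p : MarkedPartition n, p.Realizes e G := by
  obtain ⟨c, hc⟩ := exists_index_eq_iff (G.edge ∘ e.symm)
  -- Parts are nonempty, so position `0` names a leg from which the vertex of the part is read off.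
  let b₀ : Fin c.length → Fin G.numInner ⊕ Fin G.numOuter := fun j =>
    G.edge (e.symm (c.emb j ⟨0, c.partSize_pos j⟩))
  have hb₀ : ∀ l, G.edge l = b₀ (c.index (e l)) := fun l => by
    have h : c.index (e l) = c.index (c.emb (c.index (e l)) ⟨0, c.partSize_pos _⟩) :=
      (index_emb c _ _).symm
    have := (hc _ _).1 h
    simpa [b₀] using this
  have hbij : Function.Bijective b₀ := by
    refine ⟨fun j j' h => ?_, fun v => ?_⟩
    · have := (hc _ _).2 h
      rwa [index_emb, index_emb] at this
    · obtain ⟨l, rfl⟩ := G.edge_surjective v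
      exact ⟨_, (hb₀ l).symm⟩
  refine ⟨⟨c, Finset.univ.filter fun j => (b₀ j).isRight = true, fun j hj => ?_⟩,
    Equiv.ofBijective b₀ hbij, hb₀, fun j => by simp⟩
  obtain ⟨v, hv⟩ := Sum.isRight_iff.1 (Finset.mem_filter.1 hj).2
  have hall : ∀ r, G.edge (e.symm (c.emb j r)) = Sum.inr v := fun r => by
    rw [hb₀, Equiv.apply_symm_apply, index_emb, hv]
  have hsub : ∀ r r' : Fin (c.partSize j), r = r' := fun r r' =>
    (c.emb_strictMono j).injective (e.symm.injective (G.outer_unique _ _ v (hall r) (hall r')))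
  have hpos := c.partSize_pos j
  by_contra hne
  -- A marked part with a second element would have two legs at one outer vertex.
  have := hsub ⟨0, hpos⟩ ⟨1, by omega⟩
  simp at this

variable {e}

/-- Both vertex sets are identified with the same set of parts. The marks force the resulting
bijection to preserve inner and outer vertices, so it splits. -/
theorem MarkedPartition.Realizes.rel {p : MarkedPartition n} {G H : LabelledGraph m}
    (hG : p.Realizes e G) (hH : p.Realizes e H) : G.Rel H := by
  obtain ⟨b, hb, hbO⟩ := hG
  obtain ⟨b', hb', hbO'⟩ := hH
  obtain ⟨i, o, h⟩ := exists_sum_map_of_isRight (b.symm.trans b') fun x => by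
    have h1 := (hbO (b.symm x)).symm.trans (hbO' (b.symm x))
    rw [Equiv.apply_symm_apply] at h1
    exact (Bool.eq_iff_iff.2 h1).symm
  refine ⟨i, o, fun l => ?_⟩
  rw [← h, hb, hb']
  simp

/-- Relabelling changes neither which legs share a vertex nor the type of that vertex, and a marked
partition records nothing else. Hence no symmetry factors appear. -/
theorem MarkedPartition.Realizes.eq_of_rel {p p' : MarkedPartition n} {G H : LabelledGraph m}
    (hG : p.Realizes e G) (hH : p'.Realizes e H) (h : G.Rel H) : p = p' := by
  obtain ⟨c, O, hO⟩ := p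
  obtain ⟨c', O', hO'⟩ := p'
  obtain ⟨b, hb, hbO⟩ := hG
  obtain ⟨b', hb', hbO'⟩ := hH
  obtain ⟨i, o, hio⟩ := h
  simp only at b b' hb hb' hbO hbO'
  have hinj : Function.Injective (Sum.map i o) := Sum.map_injective.2 ⟨i.injective, o.injective⟩
  obtain rfl : c = c' := eq_of_index_eq_iff c c' fun x y => by
    have h1 := hio (e.symm x)
    have h2 := hio (e.symm y)
    rw [hb, hb', Equiv.apply_symm_apply] at h1 h2
    rw [← b.apply_eq_iff_eq, ← b'.apply_eq_iff_eq, h1, h2, hinj.eq_iff]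
  obtain rfl : O = O' := by
    ext j
    obtain ⟨x, rfl⟩ := index_surjective c j
    have h1 := hio (e.symm x)
    rw [hb, hb', Equiv.apply_symm_apply] at h1
    rw [hbO, hbO', h1, Sum.isRight_map]
  rfl

/-- The product over the empty vertices of a graph of factors which depend on the set of legs
joined with the vertex. -/
def LabelledGraph.weight (Fo Fi : Finset (Leg m) → ℂ) (G : LabelledGraph m) : ℂ :=
  (∏ v : Fin G.numOuter, Fo (G.legs (Sum.inr v))) * ∏ v : Fin G.numInner, Fi (G.legs (Sum.inl v))

theorem LabelledGraph.weight_eq_of_rel (Fo Fi : Finset (Leg m) → ℂ) {G H : LabelledGraph m}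
    (h : G.Rel H) : G.weight Fo Fi = H.weight Fo Fi := by
  obtain ⟨i, o, h⟩ := h
  unfold LabelledGraph.weight
  congr 1
  · refine Fintype.prod_equiv o _ _ fun v => ?_
    rw [← LabelledGraph.legs_map i o h]
    rfl
  · refine Fintype.prod_equiv i _ _ fun v => ?_
    rw [← LabelledGraph.legs_map i o h]
    rfl

/-- The legs in a part of an ordered partition. -/
def partLegs (e : Leg m ≃ Fin n) (c : OrderedFinpartition n) (j : Fin c.length) :
    Finset (Leg m) :=
  Finset.univ.filter fun l => c.index (e l) = j

theorem MarkedPartition.Realizes.weight_eq (Fo Fi : Finset (Leg m) → ℂ) {p : MarkedPartition n}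
    {G : LabelledGraph m} (hG : p.Realizes e G) : G.weight Fo Fi =
      (∏ j ∈ p.2.1, Fo (partLegs e p.1 j)) * ∏ j ∈ Finset.univ \ p.2.1, Fi (partLegs e p.1 j) := by
  classical
  obtain ⟨b, hb, hbO⟩ := hG
  have hlegs : ∀ j, G.legs (b j) = partLegs e p.1 j := fun j => by
    ext l
    simp [LabelledGraph.legs, partLegs, hb]
  let K : Fin G.numInner ⊕ Fin G.numOuter → ℂ :=
    Sum.elim (fun v => Fi (G.legs (Sum.inl v))) fun v => Fo (G.legs (Sum.inr v))
  have hK : ∀ j, K (b j) = if j ∈ p.2.1 then Fo (partLegs e p.1 j) else Fi (partLegs e p.1 j) :=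
    fun j => by
      simp only [← hlegs, hbO]
      rcases b j with v | v <;> simp [K]
  have h1 : G.weight Fo Fi = ∏ x, K x := by
    rw [Fintype.prod_sum_type, LabelledGraph.weight, mul_comm]
    rfl
  rw [h1, ← Equiv.prod_comp b K]
  simp_rw [hK]
  rw [Finset.prod_ite]
  congr 1
  · exact Finset.prod_congr (by ext; simp) fun _ _ => rfl
  · exact Finset.prod_congr (by ext; simp) fun _ _ => rfl

/-- Expand the product of sums over subsets `O` of the parts. A term survives only if `O` consists
of singletons, and such pairs are in bijection with the isomorphism classes of graphs. -/
theorem sum_weight_eq (e : Leg m ≃ Fin n) (Fo Fi : Finset (Leg m) → ℂ) :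
    ∑ G : FeynmanGraph m, (Quotient.out G : LabelledGraph m).weight Fo Fi =
      ∑ c : OrderedFinpartition n, ∏ j : Fin c.length,
        ((if c.partSize j = 1 then Fo (partLegs e c j) else 0) + Fi (partLegs e c j)) := by
  classical
  choose g hg using MarkedPartition.exists_graph e
  let q : MarkedPartition n → FeynmanGraph m := fun p =>
    Quotient.mk (LabelledGraph.setoid m) (g p)
  have hbij : Function.Bijective q := by
    refine ⟨fun p p' h => ?_, fun G => ?_⟩
    · exact (hg p).eq_of_rel (hg p') (Quotient.exact h)
    · induction G using Quotient.inductionOn with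
      | _ G =>
        obtain ⟨p, hp⟩ := G.exists_markedPartition e
        exact ⟨p, Quotient.sound ((hg p).rel hp)⟩
  have h1 : ∀ p : MarkedPartition n, (∏ j ∈ p.2.1, Fo (partLegs e p.1 j)) *
      ∏ j ∈ Finset.univ \ p.2.1, Fi (partLegs e p.1 j) =
        (Quotient.out (q p) : LabelledGraph m).weight Fo Fi := fun p => by
    rw [← (hg p).weight_eq]
    exact (LabelledGraph.weight_eq_of_rel Fo Fi (Quotient.mk_out (g p))).symm
  rw [← Fintype.sum_bijective q hbij _ _ h1, Fintype.sum_sigma]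
  refine Finset.sum_congr rfl fun c _ => ?_
  rw [Finset.prod_add, Finset.powerset_univ]
  have h2 : ∀ O : Finset (Fin c.length),
      (∏ j ∈ O, if c.partSize j = 1 then Fo (partLegs e c j) else 0) *
        ∏ j ∈ Finset.univ \ O, Fi (partLegs e c j) =
      if ∀ j ∈ O, c.partSize j = 1 then
        (∏ j ∈ O, Fo (partLegs e c j)) * ∏ j ∈ Finset.univ \ O, Fi (partLegs e c j) else 0 :=
    fun O => by
      split_ifs with hO
      · rw [Finset.prod_congr rfl fun j hj => if_pos (hO j hj)]
      · push Not at hO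
        obtain ⟨j, hj, hne⟩ := hO
        rw [Finset.prod_eq_zero hj (if_neg hne), zero_mul]
  simp_rw [h2]
  rw [← Finset.sum_filter]
  symm
  apply Finset.sum_subtype
  exact fun O => by rw [Finset.mem_filter, and_iff_right (Finset.mem_univ O)]

/-- The Feynman factor of an inner vertex does not depend on the enumeration of its legs. -/
theorem LevyTriple.coeffOn_eq (L : LevyTriple d) (hr : IsCompact L.r.support)
    (X : Leg m → Fin d) {J : Finset (Leg m)} {k : ℕ} {g : Fin k → Leg m}
    (hg : Function.Injective g) (hJ : ∀ l, l ∈ J ↔ ∃ r, g r = l) :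
    L.coeffOn X J = L.coeff k (X ∘ g) := by
  classical
  obtain rfl : J.card = k := by
    have : J = Finset.univ.image g := by ext l; simp [hJ]
    rw [this, Finset.card_image_of_injective _ hg, Finset.card_univ, Fintype.card_fin]
  have h : ∀ i : Fin J.card, ∃ r, g r = (J.equivFin.symm i : Leg m) := fun i =>
    (hJ _).1 (J.equivFin.symm i).2
  choose s hs using h
  have hsinj : Function.Injective s := fun i i' hii => by
    have : (J.equivFin.symm i : Leg m) = J.equivFin.symm i' := by rw [← hs, ← hs, hii]
    exact J.equivFin.symm.injective (Subtype.ext this)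
  let σ : Equiv.Perm (Fin J.card) := Equiv.ofBijective s (Finite.injective_iff_bijective.1 hsinj)
  rw [LevyTriple.coeffOn, ← L.coeff_perm hr (X ∘ g) σ]
  congr 1
  funext i
  exact congrArg X (hs i).symm

theorem quadV_pow (lam : Matrix (Fin d) (Fin d) ℝ) (y : E d) (m : ℕ) :
    quadV lam y ^ m = ∑ X : Leg m → Fin d, (∏ j, lam (X (j, 0)) (X (j, 1))) * ∏ l, y (X l) := by
  have h : quadV lam y = ∑ p : Fin 2 → Fin d, lam (p 0) (p 1) * y (p 0) * y (p 1) := by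
    rw [quadV, ← Fintype.sum_prod_type']
    exact (Equiv.sum_comp (finTwoArrowEquiv (Fin d))
      fun q : Fin d × Fin d => lam q.1 q.2 * y q.1 * y q.2).symm
  have h1 : quadV lam y ^ m =
      ∑ X : Fin m → Fin 2 → Fin d, ∏ j, lam (X j 0) (X j 1) * y (X j 0) * y (X j 1) := by
    rw [h, Fintype.sum_pow]
  rw [h1]
  refine (Fintype.sum_equiv (Equiv.curry (Fin m) (Fin 2) (Fin d)) _ _ fun X => ?_).symm
  rw [Fintype.prod_prod_type, ← Finset.prod_mul_distrib]
  refine Finset.prod_congr rfl fun j _ => ?_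
  rw [Fin.prod_univ_two, ← mul_assoc]
  rfl

/-- The moments of `V(φ - X)` are sums over Feynman graphs. -/
theorem LevyTriple.integral_quadV_pow (L : LevyTriple d) (hr : IsCompact L.r.support) {t : ℝ}
    {μ : Measure (E d)} (hμ : HasExpMoments μ)
    (hL : ∀ η, laplace μ η = Complex.exp (t * L.symbol η)) (lam : Matrix (Fin d) (Fin d) ℝ)
    (φ : E d) (m : ℕ) :
    ((∫ y, quadV lam y ^ m ∂(μ.map fun x => φ - x) : ℝ) : ℂ) = L.graphSum lam t φ m := by
  classical
  set e := Fintype.equivFin (Leg m) with he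
  have hμφ := hμ.map_sub φ
  -- For a fixed assignment of indices to the legs, the joint moment is already a sum over graphs;
  -- only the two finite sums remain to be exchanged.
  have hmom : ∀ X : Leg m → Fin d, ((∫ y, ∏ l, y (X l) ∂(μ.map fun x => φ - x) : ℝ) : ℂ) =
      ∑ G : FeynmanGraph m, (Quotient.out G : LabelledGraph m).weight
        (fun J => ∏ l ∈ J, (φ (X l) : ℂ)) fun J => t * L.coeffOn X J := fun X => by
    have h1 := L.moment_eq hr hμ hL φ _ (X ∘ e.symm)
    have h2 : ∀ y : E d, ∏ i, y ((X ∘ e.symm) i) = ∏ l, y (X l) := fun y =>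
      Equiv.prod_comp e.symm fun l => y (X l)
    simp_rw [h2] at h1
    rw [h1, sum_weight_eq e]
    refine Finset.sum_congr rfl fun c _ => Finset.prod_congr rfl fun j _ => ?_
    have hinj : Function.Injective (e.symm ∘ c.emb j) :=
      e.symm.injective.comp (c.emb_strictMono j).injective
    have hmem : ∀ l, l ∈ partLegs e c j ↔ ∃ r, (e.symm ∘ c.emb j) r = l := fun l => by
      simp only [partLegs, Finset.mem_filter, Finset.mem_univ, true_and, index_eq_iff,
        Function.comp_apply, Equiv.symm_apply_eq]
    have himg : partLegs e c j = Finset.univ.image (e.symm ∘ c.emb j) := by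
      ext l; simp [hmem]
    rw [L.coeffOn_eq hr X hinj hmem, himg, Finset.prod_image fun a _ b _ h => hinj h]
    rfl
  have hint : ∀ X : Leg m → Fin d, Integrable (fun y : E d => ∏ l, y (X l))
      (μ.map fun x => φ - x) := fun X => by
    have := (expBounded_prod_inner Finset.univ
      fun l => EuclideanSpace.single (X l) (1 : ℝ)).integrable hμφ
    simpa [EuclideanSpace.inner_single_right] using this
  simp_rw [quadV_pow]
  rw [integral_finsetSum _ fun X _ => (hint X).const_mul _]
  simp_rw [integral_const_mul]
  push_cast
  simp_rw [hmom, Finset.mul_sum]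
  rw [Finset.sum_comm, LevyTriple.graphSum]
  refine Finset.sum_congr rfl fun G _ => ?_
  conv_rhs => rw [← Quotient.out_eq G]
  change _ = LabelledGraph.value L lam t φ (Quotient.out G)
  unfold LabelledGraph.value LabelledGraph.weight
  exact Finset.sum_congr rfl fun X _ => by rw [mul_assoc]

end

end LevyBorel

/-! ### The solution as a Laplace transform, and the conclusion -/

namespace LevyBorel

variable {d : ℕ}

theorem measurable_quadV (lam : Matrix (Fin d) (Fin d) ℝ) : Measurable (quadV lam) :=
  (continuous_quadV lam).measurable

/-- Since `V` is quadratic, `√V` is at most a multiple of the norm, and an ordinary exponential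
moment suffices. -/
theorem integrable_exp_sqrt_quadV {lam : Matrix (Fin d) (Fin d) ℝ} (hlam : lam.PosDef)
    {μ : Measure (E d)} (hμ : HasExpMoments μ) :
    Integrable (fun y => Real.exp (√(quadV lam y))) μ := by
  obtain ⟨c, hc, h⟩ := exists_quadV_le hlam
  refine (hμ c hc.le).mono'
    (Real.continuous_exp.comp (continuous_quadV lam).sqrt).aestronglyMeasurable
    (Eventually.of_forall fun y => ?_)
  rw [Real.norm_of_nonneg (Real.exp_pos _).le]
  exact Real.exp_le_exp.2 (Real.sqrt_le_iff.2 ⟨by positivity, h y⟩)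

/-- `Φ_t^ζ(φ)` is the Laplace transform of the distribution of `V(φ - X)`. -/
theorem LevyTriple.Phi_eq_integral (L : LevyTriple d) {lam : Matrix (Fin d) (Fin d) ℝ}
    (hlam : lam.PosDef) {t : ℝ} {μ : Measure (E d)} [IsProbabilityMeasure μ]
    (hL : ∀ η, laplace μ η = Complex.exp (t * L.symbol η)) (φ : E d) {ζ : ℂ} (hζ : 0 < ζ.re) :
    L.Phi lam ζ t φ =
      ∫ y, Complex.exp (-(ζ * quadV lam y)) ∂(μ.map fun x => φ - x) := by
  have hf := regularInitial_initial hlam hζ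
  rw [LevyTriple.Phi,
    L.convolve_eq_integral hL hf.continuous hf.integrable hf.integrable_fourier φ,
    integral_map (by fun_prop)]
  · simp [initial]
  · have := continuous_quadV lam
    exact Continuous.aestronglyMeasurable (by fun_prop)

end LevyBorel

theorem theorem2p21 {d : ℕ} (L : LevyBorel.LevyTriple d) (hr : IsCompact L.r.support)
    (lam : Matrix (Fin d) (Fin d) ℝ) (hlam : lam.PosDef) :
    -- `Φ_t = Φ_t^1` is the unique solution of the Cauchy problem
    (L.IsCauchySolution (LevyBorel.initial lam 1) (L.Phi lam 1) ∧
      ∀ u : ℝ → LevyBorel.E d → ℂ, L.IsCauchySolution (LevyBorel.initial lam 1) u →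
        ∀ t : ℝ, 0 ≤ t → u t = L.Phi lam 1 t) ∧
    ∀ t : ℝ, 0 < t → ∀ φ : LevyBorel.E d, ∃ A σ : ℝ, 0 < A ∧ 0 < σ ∧
      -- the hypotheses of Watson's theorem, on the whole half plane `Re ζ > 0`
      (∀ R : ℝ, 0 < R → LevyBorel.WatsonSokal (fun ζ => L.Phi lam ζ t φ)
        (fun m => (-1) ^ m / (m.factorial : ℂ) * L.graphSum lam t φ m) R A σ) ∧
      -- the Borel transform, its analytic continuation and the Borel sum
      ∃ B : ℂ → ℂ, AnalyticOnNhd ℂ B (LevyBorel.strip σ) ∧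
        (∀ τ : ℂ, ‖τ‖ < 1 / σ →
          HasSum (fun m : ℕ => (-τ) ^ m / (m.factorial : ℂ) ^ 2 * L.graphSum lam t φ m) (B τ)) ∧
        MeasureTheory.IntegrableOn (fun τ : ℝ => Complex.exp (-(τ : ℂ)) * B (τ : ℂ))
          (Set.Ioi 0) ∧
        L.Phi lam 1 t φ = ∫ τ in Set.Ioi (0 : ℝ), Complex.exp (-(τ : ℂ)) * B (τ : ℂ) := by
  have hf := LevyBorel.regularInitial_initial hlam (ζ := 1) (by simp)
  refine ⟨⟨L.isCauchySolution_convolve hr hf, fun u hu t ht => hu.eq_convolve ht⟩,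
    fun t ht φ => ?_⟩
  obtain ⟨μ, hprob, hμ, hL⟩ := L.exists_law hr ht.le
  have hP : IsProbabilityMeasure (μ.map fun x => φ - x) :=
    Measure.isProbabilityMeasure_map (by fun_prop)
  have hexp := LevyBorel.integrable_exp_sqrt_quadV hlam (hμ.map_sub φ)
  have hW := LevyBorel.measurable_quadV lam
  have hW0 := LevyBorel.quadV_nonneg hlam
  have hmom := L.integral_quadV_pow hr hμ hL lam φ
  -- The constants are `A = E e^{√W}` and `σ = 4`; neither involves `R`.
  refine ⟨∫ y, Real.exp (√(LevyBorel.quadV lam y)) ∂(μ.map fun x => φ - x), 4,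
    integral_exp_pos hexp, by norm_num, fun R hR => ?_, ?_⟩
  · have := LevyBorel.watsonSokal_laplace hW hW0 hexp
      (fun ζ hζ => L.Phi_eq_integral hlam hL φ hζ) hR
    simpa only [hmom] using this
  · obtain ⟨B, hB, hsum, hint, hlap⟩ := LevyBorel.exists_borel_laplace hW hW0 hexp
    refine ⟨B, hB, fun τ hτ => by simpa only [hmom] using hsum τ hτ, hint, ?_⟩
    rw [← hlap, L.Phi_eq_integral hlam hL φ (by simp)]
    simp only [one_mul]
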